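/- Let $\mathbf{Y}=(Y,\mathcal{Y},\nu,T)$ be an infinite ergodic system, that is, $(Y,\mathcal{Y},\nu)$ is a standard probability space such that no finite set has full $\nu$-measure, and $T$ is an invertible $\nu$-preserving ergodic transformation of $Y$. Let $G$ be a compact second countable (Hausdorff) topological group, possibly nonabelian, with normalized Haar measure $\lambda_G$, and let $d_G$ be a metric inducing the topology of $G$ (for example a bi-invariant one). Let $\mathcal{C}(Y,G)$ be the space of Borel maps (cocycles) $\phi: Y\to G$, where maps that agree $\nu$-almost everywhere are identified, with the metric of convergence in measure $$d(\phi,\psi)=\inf\{\varepsilon : \nu(\{y\in Y : d_G(\phi(y),\psi(y))>\varepsilon\})<\varepsilon\}.$$ Then $\mathcal{C}(Y,G)$ is a Polish space, and for a generic $\phi\in\mathcal{C}(Y,G)$, i.e. for all $\phi$ in some dense $G_\delta$ subset of $\mathcal{C}(Y,G)$, the skew product system $$\mathbf{Y}_\phi=(Y\times G,\ \mathcal{Y}\otimes\mathcal{B}_G,\ \nu\times\lambda_G,\ T_\phi),\qquad T_\phi(y,g)=(Ty,\phi(y)g),$$ is ergodic. -/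

import Mathlib

open MeasureTheory Set

noncomputable section

/-- The space `𝒞(Y, G)` of measurable maps `Y → G`, two maps being identified when they agree
`ν`-almost everywhere. (A type synonym of `Y →ₘ[ν] G`, so that it can carry its own metric.) -/
def CocycleSpace {Y : Type*} [MeasurableSpace Y] (ν : Measure Y) (G : Type*)
    [TopologicalSpace G] : Type _ :=
  Y →ₘ[ν] G

namespace CocycleSpace

variable {Y : Type*} [MeasurableSpace Y] {ν : Measure Y} {G : Type*}

/-- A measurable representative of a cocycle. -/
def rep [TopologicalSpace G] (φ : CocycleSpace ν G) : Y → G :=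
  AEEqFun.cast φ

theorem stronglyMeasurable_rep [TopologicalSpace G] (φ : CocycleSpace ν G) :
    StronglyMeasurable φ.rep :=
  AEEqFun.stronglyMeasurable φ

/-- The class of a measurable map. -/
def of [TopologicalSpace G] (f : Y → G) (hf : AEStronglyMeasurable f ν) : CocycleSpace ν G :=
  AEEqFun.mk f hf

theorem rep_of_ae_eq [TopologicalSpace G] (f : Y → G) (hf : AEStronglyMeasurable f ν) :
    (of f hf).rep =ᵐ[ν] f :=
  AEEqFun.coeFn_mk f hf

theorem ext_of_ae_eq [TopologicalSpace G] {φ ψ : CocycleSpace ν G}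
    (h : φ.rep =ᵐ[ν] ψ.rep) : φ = ψ :=
  AEEqFun.ext h

variable [MetricSpace G]

/-- The set of `ε` such that `ν {y | d(φ y, ψ y) > ε} < ε`. -/
def admissible (φ ψ : CocycleSpace ν G) : Set ℝ :=
  {ε : ℝ | ν.real {y | ε < dist (φ.rep y) (ψ.rep y)} < ε}

/-- The metric of convergence in measure,
`d(φ, ψ) = inf {ε | ν {y | d(φ y, ψ y) > ε} < ε}`. -/
def measureDist (φ ψ : CocycleSpace ν G) : ℝ :=
  sInf (admissible φ ψ)

theorem pos_of_mem_admissible {φ ψ : CocycleSpace ν G} {ε : ℝ} (h : ε ∈ admissible φ ψ) :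
    0 < ε :=
  lt_of_le_of_lt measureReal_nonneg h

theorem bddBelow_admissible (φ ψ : CocycleSpace ν G) : BddBelow (admissible φ ψ) :=
  ⟨0, fun _ h => (pos_of_mem_admissible h).le⟩

theorem measureDist_nonneg (φ ψ : CocycleSpace ν G) : 0 ≤ measureDist φ ψ :=
  Real.sInf_nonneg fun _ h => (pos_of_mem_admissible h).le

theorem measureDist_le {φ ψ : CocycleSpace ν G} {ε : ℝ} (h : ε ∈ admissible φ ψ) :
    measureDist φ ψ ≤ ε :=
  csInf_le (bddBelow_admissible φ ψ) h

theorem measureDist_comm (φ ψ : CocycleSpace ν G) : measureDist φ ψ = measureDist ψ φ := by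
  simp only [measureDist, admissible, dist_comm]

variable [IsProbabilityMeasure ν]

theorem nonempty_admissible (φ ψ : CocycleSpace ν G) : (admissible φ ψ).Nonempty :=
  ⟨2, lt_of_le_of_lt measureReal_le_one (by norm_num)⟩

theorem mem_admissible_of_lt {φ ψ : CocycleSpace ν G} {ε : ℝ} (h : measureDist φ ψ < ε) :
    ε ∈ admissible φ ψ := by
  obtain ⟨δ, hδ, hlt⟩ := exists_lt_of_csInf_lt (nonempty_admissible φ ψ) h
  refine lt_of_le_of_lt (measureReal_mono ?_) (lt_trans hδ hlt)
  intro y hy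
  exact lt_trans hlt hy

theorem measureDist_self (φ : CocycleSpace ν G) : measureDist φ φ = 0 := by
  refine le_antisymm (le_of_forall_pos_le_add fun ε hε => ?_) (measureDist_nonneg φ φ)
  rw [zero_add]
  apply measureDist_le
  have : {y | ε < dist (φ.rep y) (φ.rep y)} = ∅ :=
    eq_empty_of_forall_notMem fun y hy => by
      have hy' : ε < dist (φ.rep y) (φ.rep y) := hy
      rw [dist_self] at hy'
      exact lt_asymm hε hy'
  change ν.real {y | ε < dist (φ.rep y) (φ.rep y)} < ε
  rwa [this, measureReal_empty]

theorem measureDist_triangle (φ ψ χ : CocycleSpace ν G) :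
    measureDist φ χ ≤ measureDist φ ψ + measureDist ψ χ := by
  refine le_of_forall_pos_le_add fun ε hε => ?_
  have h₁ : measureDist φ ψ + ε / 2 ∈ admissible φ ψ := mem_admissible_of_lt (by linarith)
  have h₂ : measureDist ψ χ + ε / 2 ∈ admissible ψ χ := mem_admissible_of_lt (by linarith)
  set a := measureDist φ ψ + ε / 2
  set b := measureDist ψ χ + ε / 2
  have hab : measureDist φ ψ + measureDist ψ χ + ε = a + b := by ring
  rw [hab]
  apply measureDist_le
  have hsub : {y | a + b < dist (φ.rep y) (χ.rep y)} ⊆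
      {y | a < dist (φ.rep y) (ψ.rep y)} ∪ {y | b < dist (ψ.rep y) (χ.rep y)} := by
    intro y hy
    by_contra hcon
    simp only [mem_union, mem_ofPred_eq, not_or, not_lt] at hcon hy
    linarith [dist_triangle (φ.rep y) (ψ.rep y) (χ.rep y)]
  calc ν.real {y | a + b < dist (φ.rep y) (χ.rep y)}
      ≤ ν.real ({y | a < dist (φ.rep y) (ψ.rep y)} ∪ {y | b < dist (ψ.rep y) (χ.rep y)}) :=
        measureReal_mono hsub
    _ ≤ ν.real {y | a < dist (φ.rep y) (ψ.rep y)} + ν.real {y | b < dist (ψ.rep y) (χ.rep y)} :=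
        measureReal_union_le _ _
    _ < a + b := add_lt_add h₁ h₂

theorem eq_of_measureDist_eq_zero {φ ψ : CocycleSpace ν G} (h : measureDist φ ψ = 0) :
    φ = ψ := by
  apply ext_of_ae_eq
  have key : ∀ δ : ℝ, 0 < δ → ν.real {y | δ < dist (φ.rep y) (ψ.rep y)} = 0 := by
    intro δ hδ
    refine le_antisymm (le_of_forall_pos_le_add fun ε hε => ?_) measureReal_nonneg
    have hm : min δ ε ∈ admissible φ ψ := mem_admissible_of_lt (by rw [h]; exact lt_min hδ hε)
    rw [zero_add]
    refine le_trans (measureReal_mono ?_) (le_trans (le_of_lt hm) (min_le_right δ ε))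
    intro y hy
    exact lt_of_le_of_lt (min_le_left δ ε) hy
  have hall : ∀ n : ℕ, ∀ᵐ y ∂ν, dist (φ.rep y) (ψ.rep y) ≤ 1 / ((n : ℝ) + 1) := by
    intro n
    have h0 := key (1 / ((n : ℝ) + 1)) (by positivity)
    rw [measureReal_eq_zero_iff] at h0
    rw [ae_iff]
    simpa only [not_le] using h0
  filter_upwards [ae_all_iff.2 hall] with y hy
  refine dist_le_zero.1 (le_of_forall_pos_lt_add fun ε hε => ?_)
  obtain ⟨n, hn⟩ := exists_nat_one_div_lt hε
  linarith [hy n]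

instance instMetricSpace : MetricSpace (CocycleSpace ν G) where
  dist := measureDist
  dist_self := measureDist_self
  dist_comm := measureDist_comm
  dist_triangle := measureDist_triangle
  eq_of_dist_eq_zero := eq_of_measureDist_eq_zero

end CocycleSpace

/-- The skew product transformation `T_φ (y, g) = (T y, φ(y) g)` of `Y × G`. -/
def skewProduct {Y G : Type*} [Mul G] (T : Y → Y) (φ : Y → G) : Y × G → Y × G :=
  fun p => (T p.1, φ p.1 * p.2)

/-- The normalized Haar measure of a compact group: the Haar measure giving mass `1` to the
whole group. -/
def normalizedHaar (G : Type*) [Group G] [TopologicalSpace G] [IsTopologicalGroup G]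
    [CompactSpace G] [MeasurableSpace G] [BorelSpace G] : Measure G :=
  Measure.haarMeasure (⊤ : TopologicalSpace.PositiveCompacts G)

/-- The probability space `(Y, ν)` is infinite: `ν` is not carried by a finite set. -/
def IsInfiniteSystem {Y : Type*} [MeasurableSpace Y] (ν : Measure Y) : Prop :=
  ∀ F : Set Y, F.Finite → ν F ≠ 1

end

open Filter Topology

namespace CocycleSpace

/-! Polishness: Borel–Cantelli gives completeness of convergence in measure, and maps assembled from
a countable dense family of sets and a dense sequence in `G` give separability.

Genericity is a Baire argument. `T_φ` is ergodic once, for each `f` in a countable `L¹`-dense family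
and each `δ`, some ergodic average of `f` is `δ`-close in `L¹` to its integral. For `f` continuous
in the group variable, the `L¹` distance at a fixed time depends continuously on `φ`, so each
condition is open and everything reduces to its density.

A clock that advances by one along orbits off a small set shows that coboundaries `b(Ty) b(y)⁻¹` are
dense. Along such a cocycle, `(y, g) ↦ (y, b(y) g)` conjugates `T × id` to `T_φ`, so averages
converge to the fibre integral `F(g) = ∫ f(y, b(y) g) dν`, which need not be constant. Now replace
`b` by `b · x(κ)`, where the colouring `κ : Y → ZMod K` is almost invariant and almost
equidistributed. Almost invariance makes the change of cocycle small. It also makes the colour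
classes almost independent of every fixed function of `y` (mean ergodic theorem), so `F(g)` becomes
nearly `K⁻¹ ∑ⱼ F(xⱼ g)`. A second-moment argument on the group selects `xⱼ` for which this is close
in `L¹` to `∫ F`. -/

theorem of_rep {Y : Type*} [MeasurableSpace Y] {ν : Measure Y} {G : Type*} [MetricSpace G]
    (φ : CocycleSpace ν G) : of φ.rep φ.stronglyMeasurable_rep.aestronglyMeasurable = φ :=
  ext_of_ae_eq (rep_of_ae_eq _ _)

/-! ### Convergence in measure and completeness. -/

section Topology

variable {Y : Type*} [MeasurableSpace Y] {ν : Measure Y} [IsProbabilityMeasure ν]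
  {G : Type*} [MetricSpace G]

theorem dist_le_of_measureReal_ne_lt {φ ψ : CocycleSpace ν G} {ε : ℝ}
    (h : ν.real {y | φ.rep y ≠ ψ.rep y} < ε) : dist φ ψ ≤ ε := by
  have hε : 0 < ε := lt_of_le_of_lt measureReal_nonneg h
  refine measureDist_le (lt_of_le_of_lt (measureReal_mono ?_) h)
  intro y hy heq
  have hy' : ε < dist (φ.rep y) (ψ.rep y) := hy
  rw [heq, dist_self] at hy'
  exact lt_asymm hε hy'

theorem dist_of_le {f g : Y → G} (hf : AEStronglyMeasurable f ν) (hg : AEStronglyMeasurable g ν)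
    {ε : ℝ} (h : ν.real {y | f y ≠ g y} < ε) : dist (of f hf) (of g hg) ≤ ε := by
  apply dist_le_of_measureReal_ne_lt
  rwa [measureReal_congr (t := {y | f y ≠ g y})]
  filter_upwards [rep_of_ae_eq f hf, rep_of_ae_eq g hg] with y h1 h2
  change ((of f hf).rep y ≠ (of g hg).rep y) = (f y ≠ g y)
  rw [h1, h2]

theorem tendsto_iff_tendstoInMeasure {ι : Type*} {l : Filter ι} {u : ι → CocycleSpace ν G}
    {φ : CocycleSpace ν G} :
    Tendsto u l (𝓝 φ) ↔ TendstoInMeasure ν (fun i => (u i).rep) l φ.rep := by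
  rw [tendstoInMeasure_iff_measureReal_dist, Metric.tendsto_nhds]
  constructor
  · intro h ε hε
    rw [Metric.tendsto_nhds]
    intro δ hδ
    -- Halving `ε` passes from the non-strict threshold of `TendstoInMeasure` to the strict one in
    -- the metric.
    filter_upwards [h (min (ε / 2) δ) (lt_min (half_pos hε) hδ)] with i hi
    have hm := mem_admissible_of_lt hi
    rw [Real.dist_eq, sub_zero, abs_of_nonneg measureReal_nonneg]
    refine lt_of_le_of_lt (measureReal_mono ?_) (lt_of_lt_of_le hm (min_le_right _ _))
    intro y hy
    exact lt_of_le_of_lt (min_le_left _ _) (lt_of_lt_of_le (half_lt_self hε) hy)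
  · intro h ε hε
    filter_upwards [(h (ε / 2) (half_pos hε)).eventually_lt_const (half_pos hε)] with i hi
    refine lt_of_le_of_lt (measureDist_le (ε := ε / 2) ?_) (half_lt_self hε)
    refine lt_of_le_of_lt (measureReal_mono ?_) hi
    intro y hy
    rw [mem_ofPred_eq] at hy ⊢
    exact hy.le

theorem tendsto_of_ae_tendsto {u : ℕ → CocycleSpace ν G} {φ : CocycleSpace ν G}
    (h : ∀ᵐ y ∂ν, Tendsto (fun n => (u n).rep y) atTop (𝓝 (φ.rep y))) :
    Tendsto u atTop (𝓝 φ) :=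
  tendsto_iff_tendstoInMeasure.2 <| tendstoInMeasure_of_tendsto_ae
    (fun n => (u n).stronglyMeasurable_rep.aestronglyMeasurable) h

theorem exists_subseq_ae_tendsto {u : ℕ → CocycleSpace ν G} {φ : CocycleSpace ν G}
    (h : Tendsto u atTop (𝓝 φ)) :
    ∃ ns : ℕ → ℕ, StrictMono ns ∧
      ∀ᵐ y ∂ν, Tendsto (fun n => (u (ns n)).rep y) atTop (𝓝 (φ.rep y)) :=
  (tendsto_iff_tendstoInMeasure.1 h).exists_seq_tendsto_ae

/-- Steps of size below `2⁻ⁿ` in the metric move points by more than `2⁻ⁿ` only on sets of summable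
measure, so by Borel–Cantelli almost every pointwise sequence is Cauchy. -/
instance instCompleteSpace [CompleteSpace G] : CompleteSpace (CocycleSpace ν G) := by
  refine Metric.complete_of_convergent_controlled_sequences (fun n => (1 / 2 : ℝ) ^ n)
    (fun n => by positivity) fun u hu => ?_
  set s : ℕ → Set Y := fun n => {y | (1 / 2 : ℝ) ^ n < dist ((u n).rep y) ((u (n + 1)).rep y)}
  have hs : ∀ n, ν (s n) ≤ ENNReal.ofReal ((1 / 2 : ℝ) ^ n) := by
    intro n
    have hm : ν.real (s n) < _ := mem_admissible_of_lt (hu n n (n + 1) le_rfl (Nat.le_succ n))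
    rw [← ofReal_measureReal]
    exact ENNReal.ofReal_le_ofReal hm.le
  have hsum : ∑' n, ν (s n) ≠ ⊤ := by
    refine ne_top_of_le_ne_top ?_ (ENNReal.tsum_le_tsum hs)
    exact summable_geometric_two.tsum_ofReal_ne_top
  have hlim : ∀ᵐ y ∂ν, ∃ l, Tendsto (fun n => (u n).rep y) atTop (𝓝 l) := by
    filter_upwards [ae_eventually_notMem hsum] with y hy
    obtain ⟨N, hN⟩ := eventually_atTop.1 hy
    have hc : CauchySeq fun n => (u (n + N)).rep y := by
      refine cauchySeq_of_le_geometric_two (C := 2) fun n => ?_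
      have h1 := hN (n + N) (Nat.le_add_left N n)
      rw [mem_ofPred_eq, not_lt] at h1
      rw [add_right_comm]
      refine h1.trans ?_
      rw [one_div, inv_pow, div_self two_ne_zero, ← one_div]
      exact one_div_le_one_div_of_le (by positivity)
        (pow_le_pow_right₀ one_le_two (Nat.le_add_right n N))
    obtain ⟨l, hl⟩ := cauchySeq_tendsto_of_complete hc
    exact ⟨l, (tendsto_add_atTop_iff_nat N).1 hl⟩
  obtain ⟨f, hf, hfl⟩ := exists_stronglyMeasurable_limit_of_tendsto_ae
    (fun n => (u n).stronglyMeasurable_rep.aestronglyMeasurable) hlim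
  refine ⟨of f hf.aestronglyMeasurable, tendsto_of_ae_tendsto ?_⟩
  filter_upwards [hfl, rep_of_ae_eq f hf.aestronglyMeasurable] with y h1 h2
  rwa [h2]

end Topology

/-! ### Separability. -/

section Separable

variable {Y : Type*} [MeasurableSpace Y] {ν : Measure Y} [IsProbabilityMeasure ν]
  {G : Type*} [MetricSpace G]

open Classical in
/-- The index read off from finitely many sets: the sum of the `i` with `y ∈ B i`. -/
noncomputable def setIndex {n : ℕ} (B : Fin n → Set Y) (y : Y) : ℕ :=
  ∑ i : Fin n, if y ∈ B i then (i : ℕ) else 0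

theorem measurable_setIndex {n : ℕ} {B : Fin n → Set Y} (hB : ∀ i, MeasurableSet (B i)) :
    Measurable (setIndex B) :=
  Finset.measurable_fun_sum _ fun i _ =>
    Measurable.ite (hB i) measurable_const measurable_const

/-- Off the symmetric differences of `B i` with the level sets of `c`, a point lies in exactly one
`B i`, namely the one with `i = c y`, and the sum returns that index. -/
theorem exists_setIndex_approx {𝒜 : Set (Set Y)} (h𝒜 : ν.MeasureDense 𝒜) {n : ℕ} {c : Y → ℕ}
    (hc : Measurable c) (hcn : ∀ y, c y < n) {ε : ℝ} (hε : 0 < ε) :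
    ∃ B : Fin n → 𝒜, ν.real {y | setIndex (fun i => (B i : Set Y)) y ≠ c y} < ε := by
  have hn : 0 < (n : ℝ) := by
    obtain ⟨y⟩ : Nonempty Y := nonempty_of_isProbabilityMeasure ν
    exact_mod_cast (Nat.zero_le _).trans_lt (hcn y)
  have : ∀ i : Fin n, ∃ B : 𝒜, ν.real (symmDiff {y | c y = i} (B : Set Y)) < ε / n := by
    intro i
    obtain ⟨t, ht, h⟩ := h𝒜.approx {y | c y = i} (hc (measurableSet_singleton _))
      (measure_ne_top _ _) (ε / n) (by positivity)
    exact ⟨⟨t, ht⟩, (ENNReal.lt_ofReal_iff_toReal_lt (measure_ne_top _ _)).1 h⟩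
  choose B hB using this
  refine ⟨B, ?_⟩
  have hsub : {y | setIndex (fun i => (B i : Set Y)) y ≠ c y} ⊆
      ⋃ i : Fin n, symmDiff {y | c y = i} (B i : Set Y) := by
    intro y hy
    by_contra hcon
    simp only [mem_iUnion, not_exists, mem_symmDiff, mem_ofPred_eq, not_or, not_and, not_not] at hcon
    apply hy
    have hiff : ∀ i : Fin n, y ∈ (B i : Set Y) ↔ i = ⟨c y, hcn y⟩ := fun i =>
      ⟨fun h => Fin.ext ((hcon i).2 h).symm, fun h => (hcon i).1 (by rw [h])⟩
    simp only [setIndex, hiff, Finset.sum_ite_eq', Finset.mem_univ, if_true]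
  have hne : (Finset.univ : Finset (Fin n)).Nonempty := by
    have : 0 < n := by exact_mod_cast hn
    exact ⟨⟨0, this⟩, Finset.mem_univ _⟩
  calc ν.real _ ≤ ν.real (⋃ i : Fin n, symmDiff {y | c y = i} (B i : Set Y)) := measureReal_mono hsub
    _ ≤ ∑ i : Fin n, ν.real (symmDiff {y | c y = i} (B i : Set Y)) := measureReal_iUnion_fintype_le _
    _ < ∑ _i : Fin n, ε / n := Finset.sum_lt_sum_of_nonempty hne fun i _ => hB i
    _ = ε := by
      rw [Finset.sum_const, Finset.card_univ, Fintype.card_fin, nsmul_eq_mul]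
      field_simp

instance instSeparableSpace [IsSeparable ν] [TopologicalSpace.SeparableSpace G] :
    TopologicalSpace.SeparableSpace (CocycleSpace ν G) := by
  rcases isEmpty_or_nonempty (CocycleSpace ν G) with hemp | ⟨⟨φ₀⟩⟩
  · infer_instance
  obtain ⟨y₀⟩ : Nonempty Y := nonempty_of_isProbabilityMeasure ν
  have : Nonempty G := ⟨φ₀.rep y₀⟩
  borelize G
  obtain ⟨e, he⟩ := TopologicalSpace.exists_dense_seq G
  obtain ⟨𝒜, h𝒜c, h𝒜⟩ := exists_countable_measureDense ν
  have : Countable 𝒜 := h𝒜c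
  have hsm : ∀ {c : Y → ℕ}, Measurable c → AEStronglyMeasurable (fun y => e (c y)) ν :=
    fun hc => ((measurable_from_top (f := e)).stronglyMeasurable.comp_measurable hc).aestronglyMeasurable
  -- Overlapping sets may produce an index beyond `n`; this is harmless because `e` is defined on
  -- all of `ℕ`.
  let D : (Σ n : ℕ, Fin n → 𝒜) → CocycleSpace ν G := fun p =>
    of (fun y => e (setIndex (fun i => (p.2 i : Set Y)) y))
      (hsm (measurable_setIndex fun i => h𝒜.measurable _ (p.2 i).2))
  refine ⟨⟨range D, countable_range D, Metric.dense_iff.2 fun φ r hr => ?_⟩⟩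
  have hφ : Measurable φ.rep := φ.stronglyMeasurable_rep.measurable
  let c : ℕ → Y → ℕ := fun N y => SimpleFunc.nearestPtInd e N (φ.rep y)
  have hcm : ∀ N, Measurable (c N) := fun N => (SimpleFunc.measurable _).comp hφ
  have htend : Tendsto (fun N => of (fun y => e (c N y)) (hsm (hcm N))) atTop (𝓝 φ) := by
    apply tendsto_of_ae_tendsto
    filter_upwards [ae_all_iff.2 fun N => rep_of_ae_eq _ (hsm (hcm N))] with y hy
    simp only [hy]
    exact SimpleFunc.tendsto_nearestPt (he (φ.rep y))
  obtain ⟨N, hN⟩ := ((Metric.tendsto_nhds.1 htend) (r / 2) (half_pos hr)).exists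
  obtain ⟨B, hB⟩ := exists_setIndex_approx h𝒜 (n := N + 1) (hcm N)
    (fun y => Nat.lt_succ_of_le (SimpleFunc.nearestPtInd_le e N (φ.rep y))) (ε := r / 4) (by positivity)
  refine ⟨D ⟨N + 1, B⟩, ?_, mem_range_self _⟩
  have h1 : dist (D ⟨N + 1, B⟩) (of (fun y => e (c N y)) (hsm (hcm N))) ≤ r / 4 := by
    refine dist_of_le _ _ (lt_of_le_of_lt (measureReal_mono ?_) hB)
    exact fun y hy h => hy (congrArg e h)
  rw [Metric.mem_ball]
  linarith [dist_triangle (D ⟨N + 1, B⟩) (of (fun y => e (c N y)) (hsm (hcm N))) φ]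

theorem polishSpace [IsSeparable ν] [TopologicalSpace.SeparableSpace G] [CompleteSpace G] :
    PolishSpace (CocycleSpace ν G) :=
  have := UniformSpace.secondCountable_of_separable (CocycleSpace ν G)
  inferInstance

end Separable

end CocycleSpace

/-! ### Birkhoff averages of real functions. -/

theorem birkhoffAverage_eq_sum {X : Type*} (S : X → X) (u : X → ℝ) (N : ℕ) (x : X) :
    birkhoffAverage ℝ S u N x = (N : ℝ)⁻¹ * ∑ n ∈ Finset.range N, u (S^[n] x) := rfl

theorem abs_birkhoffAverage_le {X : Type*} {S : X → X} {u : X → ℝ} {C : ℝ}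
    (hC : ∀ x, |u x| ≤ C) (N : ℕ) (x : X) :
    |birkhoffAverage ℝ S u N x| ≤ C := by
  have hC0 : 0 ≤ C := (abs_nonneg _).trans (hC x)
  rcases Nat.eq_zero_or_pos N with rfl | hN
  · simpa using hC0
  have hN' : (0 : ℝ) < N := by exact_mod_cast hN
  rw [birkhoffAverage_eq_sum, abs_mul, abs_of_pos (inv_pos.2 hN'), inv_mul_le_iff₀ hN']
  calc |∑ n ∈ Finset.range N, u (S^[n] x)| ≤ ∑ n ∈ Finset.range N, |u (S^[n] x)| :=
        Finset.abs_sum_le_sum_abs _ _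
    _ ≤ ∑ _n ∈ Finset.range N, C := Finset.sum_le_sum fun n _ => hC _
    _ = N * C := by rw [Finset.sum_const, Finset.card_range, nsmul_eq_mul]

section BirkhoffAverage

variable {X : Type*} [MeasurableSpace X] {μ : Measure X} {S : X → X} {u : X → ℝ}

theorem Measurable.birkhoffAverage (hu : Measurable u) (hS : Measurable S) (N : ℕ) :
    Measurable (birkhoffAverage ℝ S u N) := by
  change Measurable fun x => (N : ℝ)⁻¹ * ∑ n ∈ Finset.range N, u (S^[n] x)
  exact (Finset.measurable_fun_sum _ fun n _ => hu.comp (hS.iterate n)).const_mul _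

theorem MeasureTheory.Integrable.comp_iterate (hu : Integrable u μ) (hS : MeasurePreserving S μ μ)
    (n : ℕ) : Integrable (fun x => u (S^[n] x)) μ :=
  (hS.iterate n).integrable_comp_of_integrable hu

theorem MeasureTheory.MeasurePreserving.integral_comp_eq {Z : Type*} [MeasurableSpace Z]
    {ρ : Measure Z} {f : X → Z}
    (hf : MeasurePreserving f μ ρ) {v : Z → ℝ} (hv : AEStronglyMeasurable v ρ) :
    ∫ x, v (f x) ∂μ = ∫ z, v z ∂ρ := by
  rw [← hf.map_eq] at hv ⊢
  exact (integral_map hf.measurable.aemeasurable hv).symm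

theorem MeasureTheory.Integrable.birkhoffAverage (hu : Integrable u μ)
    (hS : MeasurePreserving S μ μ) (N : ℕ) : Integrable (birkhoffAverage ℝ S u N) μ := by
  change Integrable (fun x => (N : ℝ)⁻¹ * ∑ n ∈ Finset.range N, u (S^[n] x)) μ
  exact (integrable_finsetSum _ fun n _ => hu.comp_iterate hS n).const_mul _

theorem integral_birkhoffAverage (hu : Integrable u μ) (hS : MeasurePreserving S μ μ) {N : ℕ}
    (hN : N ≠ 0) : ∫ x, birkhoffAverage ℝ S u N x ∂μ = ∫ x, u x ∂μ := by
  have hN' : (N : ℝ) ≠ 0 := by exact_mod_cast hN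
  simp only [birkhoffAverage_eq_sum]
  rw [integral_const_mul, integral_finsetSum _ fun n _ => hu.comp_iterate hS n]
  simp only [fun n => (hS.iterate n).integral_comp_eq hu.aestronglyMeasurable]
  rw [Finset.sum_const, Finset.card_range, nsmul_eq_mul, inv_mul_cancel_left₀ hN']

theorem integral_abs_birkhoffAverage_le (hu : Integrable u μ) (hS : MeasurePreserving S μ μ)
    (N : ℕ) : ∫ x, |birkhoffAverage ℝ S u N x| ∂μ ≤ ∫ x, |u x| ∂μ := by
  rcases eq_or_ne N 0 with rfl | hN
  · simpa using integral_nonneg fun x => abs_nonneg (u x)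
  rw [← integral_birkhoffAverage (u := fun x => |u x|) hu.abs hS hN]
  refine integral_mono (hu.birkhoffAverage hS N).abs (hu.abs.birkhoffAverage hS N) fun x => ?_
  simp only [birkhoffAverage_eq_sum, abs_mul, abs_inv, Nat.abs_cast]
  exact mul_le_mul_of_nonneg_left (Finset.abs_sum_le_sum_abs _ _) (by positivity)

theorem integrable_of_abs_le [IsFiniteMeasure μ] (hu : Measurable u) {C : ℝ}
    (hC : ∀ x, |u x| ≤ C) : Integrable u μ :=
  Integrable.of_bound hu.aestronglyMeasurable C (ae_of_all _ hC)

end BirkhoffAverage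

/-! ### Mean ergodic theorem and asymptotically invariant sets. -/

section MeanErgodic

variable {X : Type*} [MeasurableSpace X] {μ : Measure X} [IsProbabilityMeasure μ] {S : X → X}

theorem integral_abs_le_norm_Lp_two (f : Lp ℝ 2 μ) : ∫ x, |f x| ∂μ ≤ ‖f‖ := by
  have h := eLpNorm_le_eLpNorm_of_exponent_le (μ := μ) (p := 1) (q := 2) one_le_two
    (Lp.aestronglyMeasurable f)
  rw [Lp.norm_def]
  refine le_trans (le_of_eq ?_) (ENNReal.toReal_mono (Lp.eLpNorm_ne_top f) h)
  rw [eLpNorm_one_eq_lintegral_enorm, ← integral_norm_eq_lintegral_enorm (Lp.aestronglyMeasurable f)]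
  rfl

/-- The mean ergodic theorem in `L¹`, for bounded functions. -/
theorem Ergodic.tendsto_integral_abs_birkhoffAverage_sub (hS : Ergodic S μ) {u : X → ℝ}
    (hu : Measurable u) {C : ℝ} (hC : ∀ x, |u x| ≤ C) :
    Tendsto (fun N => ∫ x, |birkhoffAverage ℝ S u N x - ∫ z, u z ∂μ| ∂μ) atTop (𝓝 0) := by
  have hmp := hS.toMeasurePreserving
  have hui : Integrable u μ := integrable_of_abs_le hu hC
  have huL : MemLp u 2 μ := MemLp.of_bound hu.aestronglyMeasurable C (ae_of_all _ hC)
  let U : Lp ℝ 2 μ →L[ℝ] Lp ℝ 2 μ :=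
    (Lp.compMeasurePreservingₗᵢ ℝ S hmp : Lp ℝ 2 μ →ₗᵢ[ℝ] Lp ℝ 2 μ).toContinuousLinearMap
  have hU : ∀ f : Lp ℝ 2 μ, U f =ᵐ[μ] f ∘ S := fun f => Lp.coeFn_compMeasurePreserving f hmp
  -- Von Neumann's theorem for the Koopman operator: the limit is a fixed vector, hence constant by
  -- ergodicity.
  have hlim := U.tendsto_birkhoffAverage_orthogonalProjection
    (LinearIsometry.norm_toContinuousLinearMap_le _) (huL.toLp u)
  set P := (U.eqLocus (1 : Lp ℝ 2 μ →L[ℝ] Lp ℝ 2 μ)).orthogonalProjectionOnto (huL.toLp u)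
  set z : Lp ℝ 2 μ := (P : Lp ℝ 2 μ)
  have hz : U z = z := P.2
  have hzS : (z : X → ℝ) ∘ S =ᵐ[μ] z := by
    have h := hU z
    rw [hz] at h
    exact h.symm
  obtain ⟨c, hc⟩ := hS.ae_eq_const_of_ae_eq_comp_ae (Lp.aestronglyMeasurable z) hzS
  have hiter : ∀ n : ℕ, (U^[n] (huL.toLp u) : Lp ℝ 2 μ) =ᵐ[μ] fun x => u (S^[n] x) := by
    intro n
    induction n with
    | zero => exact huL.coeFn_toLp
    | succ n ih =>
      rw [Function.iterate_succ_apply']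
      refine (hU _).trans ?_
      have := hmp.quasiMeasurePreserving.ae_eq_comp ih
      refine this.trans (ae_of_all _ fun x => ?_)
      simp only [Function.comp, ← Function.iterate_succ_apply]
  have havg : ∀ N : ℕ, (birkhoffAverage ℝ U _root_.id N (huL.toLp u) - z : Lp ℝ 2 μ) =ᵐ[μ]
      fun x => birkhoffAverage ℝ S u N x - c := by
    intro N
    have h1 : (birkhoffAverage ℝ U _root_.id N (huL.toLp u) : Lp ℝ 2 μ) =ᵐ[μ]
        fun x => birkhoffAverage ℝ S u N x := by
      refine (Lp.coeFn_smul _ _).trans ?_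
      have h2 : (birkhoffSum U _root_.id N (huL.toLp u) : Lp ℝ 2 μ) =ᵐ[μ]
          ∑ n ∈ Finset.range N, ⇑(U^[n] (huL.toLp u)) := Lp.coeFn_finsetSum _ _
      filter_upwards [h2, ae_all_iff.2 hiter] with x hx hx'
      rw [Pi.smul_apply, hx, Finset.sum_apply, birkhoffAverage_eq_sum, smul_eq_mul]
      simp only [hx']
    filter_upwards [Lp.coeFn_sub (birkhoffAverage ℝ U _root_.id N (huL.toLp u)) z, h1, hc]
      with x h1 h2 h3
    rw [h1, Pi.sub_apply, h2, h3]
    rfl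
  have hle : ∀ N : ℕ, ∫ x, |birkhoffAverage ℝ S u N x - c| ∂μ ≤
      ‖birkhoffAverage ℝ U _root_.id N (huL.toLp u) - z‖ := by
    intro N
    refine le_trans (le_of_eq (integral_congr_ae ?_)) (integral_abs_le_norm_Lp_two _)
    filter_upwards [havg N] with x hx
    rw [hx]
  have hlim' : Tendsto (fun N => ∫ x, |birkhoffAverage ℝ S u N x - c| ∂μ) atTop (𝓝 0) :=
    squeeze_zero (fun N => integral_nonneg fun x => abs_nonneg _) hle
      (tendsto_iff_norm_sub_tendsto_zero.1 hlim)
  have hcu : ∫ x, u x ∂μ = c := by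
    refine eq_of_abs_sub_nonpos (ge_of_tendsto hlim' ?_)
    filter_upwards [eventually_ne_atTop 0] with N hN
    have h1 : ∫ x, (birkhoffAverage ℝ S u N x - c) ∂μ = ∫ x, u x ∂μ - c := by
      rw [integral_sub (hui.birkhoffAverage hmp N) (integrable_const c),
        integral_birkhoffAverage hui hmp hN]
      simp
    rw [← h1]
    exact abs_integral_le_integral_abs
  rwa [hcu]

theorem abs_setIntegral_sub_setIntegral_le {u : X → ℝ} (hu : Integrable u μ) {C : ℝ}
    (hC : ∀ x, |u x| ≤ C) {A B : Set X} (hA : MeasurableSet A) (hB : MeasurableSet B) :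
    |∫ x in A, u x ∂μ - ∫ x in B, u x ∂μ| ≤ C * μ.real (symmDiff A B) := by
  rw [← integral_indicator hA, ← integral_indicator hB,
    ← integral_sub (hu.indicator hA) (hu.indicator hB)]
  refine abs_integral_le_integral_abs.trans ?_
  rw [mul_comm, ← smul_eq_mul, ← setIntegral_const, ← integral_indicator (hA.symmDiff hB)]
  refine integral_mono ((hu.indicator hA).sub (hu.indicator hB)).abs
    ((integrable_const C).indicator (hA.symmDiff hB)) fun x => ?_
  have hC0 : 0 ≤ C := (abs_nonneg _).trans (hC x)
  by_cases h1 : x ∈ A <;> by_cases h2 : x ∈ B <;> simp [h1, h2, mem_symmDiff, hC x]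

/-- Asymptotically invariant sets are asymptotically independent of every bounded function. -/
theorem Ergodic.tendsto_setIntegral_of_asymptoticallyInvariant (hS : Ergodic S μ) {u : X → ℝ}
    (hu : Measurable u) {C : ℝ} (hC : ∀ x, |u x| ≤ C) {E : ℕ → Set X}
    (hE : ∀ m, MeasurableSet (E m)) {p : ℝ}
    (hinv : Tendsto (fun m => μ.real (symmDiff (S ⁻¹' E m) (E m))) atTop (𝓝 0))
    (hp : Tendsto (fun m => μ.real (E m)) atTop (𝓝 p)) :
    Tendsto (fun m => ∫ x in E m, u x ∂μ) atTop (𝓝 (p * ∫ x, u x ∂μ)) := by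
  have hmp := hS.toMeasurePreserving
  have hui : Integrable u μ := integrable_of_abs_le hu hC
  -- Since `∫_E u ∘ Sⁿ = ∫_{S⁻¹E} u ∘ Sⁿ⁺¹`, each further composition with `S` costs at most `C ·
  -- μ(S⁻¹E ∆ E)`.
  have hstep : ∀ n : ℕ, Tendsto (fun m => ∫ x in E m, u (S^[n] x) ∂μ - ∫ x in E m, u x ∂μ)
      atTop (𝓝 0) := by
    intro n
    induction n with
    | zero => simp
    | succ n ih =>
      have hd : Tendsto (fun m => ∫ x in E m, u (S^[n + 1] x) ∂μ - ∫ x in E m, u (S^[n] x) ∂μ)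
          atTop (𝓝 0) := by
        refine squeeze_zero_norm (a := fun m => C * μ.real (symmDiff (S ⁻¹' E m) (E m)))
          (fun m => ?_) (by simpa using hinv.const_mul C)
        have h1 : ∫ x in E m, u (S^[n] x) ∂μ = ∫ x in S ⁻¹' E m, u (S^[n + 1] x) ∂μ := by
          rw [← integral_indicator (hE m), ← integral_indicator (hmp.measurable (hE m)),
            ← hmp.integral_comp_eq ((hui.comp_iterate hmp n).indicator (hE m)).aestronglyMeasurable]
          rfl
        rw [h1, Real.norm_eq_abs, abs_sub_comm]
        exact abs_setIntegral_sub_setIntegral_le (hui.comp_iterate hmp (n + 1)) (fun x => hC _)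
          (hmp.measurable (hE m)) (hE m)
      simpa using hd.add ih
  have havg : ∀ N : ℕ, N ≠ 0 → Tendsto (fun m => ∫ x in E m, birkhoffAverage ℝ S u N x ∂μ -
      ∫ x in E m, u x ∂μ) atTop (𝓝 0) := by
    intro N hN
    have hN' : (N : ℝ) ≠ 0 := by exact_mod_cast hN
    have h := (tendsto_finsetSum (Finset.range N) fun n _ => hstep n).const_mul (N : ℝ)⁻¹
    simp only [Finset.sum_const_zero, mul_zero] at h
    refine h.congr fun m => ?_
    rw [Finset.sum_sub_distrib, Finset.sum_const, Finset.card_range, nsmul_eq_mul, mul_sub,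
      inv_mul_cancel_left₀ hN']
    simp only [birkhoffAverage_eq_sum]
    rw [integral_const_mul, integral_finsetSum _ fun n _ => (hui.comp_iterate hmp n).integrableOn]
  set c := ∫ x, u x ∂μ
  rw [Metric.tendsto_nhds]
  intro ε hε
  -- `N` is fixed before `m`: the `L¹` bound on the whole space controls the integral over every `E
  -- m` at once.
  obtain ⟨N, hN, hN0⟩ := (((hS.tendsto_integral_abs_birkhoffAverage_sub hu hC).eventually_lt_const
    (show (0 : ℝ) < ε / 3 by positivity)).and (eventually_ne_atTop 0)).exists
  filter_upwards [(Metric.tendsto_nhds.1 (havg N hN0)) (ε / 3) (by positivity),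
    (Metric.tendsto_nhds.1 (hp.mul_const c)) (ε / 3) (by positivity)] with m h1 h2
  have h3 : |∫ x in E m, birkhoffAverage ℝ S u N x ∂μ - μ.real (E m) * c| < ε / 3 := by
    have hi := hui.birkhoffAverage hmp N
    have h4 : ∫ x in E m, (birkhoffAverage ℝ S u N x - c) ∂μ =
        ∫ x in E m, birkhoffAverage ℝ S u N x ∂μ - μ.real (E m) * c := by
      rw [integral_sub hi.integrableOn (integrable_const c).integrableOn, setIntegral_const,
        smul_eq_mul]
    rw [← h4]
    refine lt_of_le_of_lt (abs_integral_le_integral_abs.trans ?_) hN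
    exact setIntegral_le_integral (hi.sub (integrable_const c)).abs
      (ae_of_all _ fun x => abs_nonneg _)
  rw [Real.dist_eq, sub_zero] at h1
  rw [Real.dist_eq] at h2 ⊢
  rw [abs_lt] at *
  constructor <;> linarith [h1.1, h1.2, h2.1, h2.2, h3.1, h3.2]

end MeanErgodic

/-! ### Absence of atoms and the clock. -/

section Tower

variable {Y : Type*} [MeasurableSpace Y] {ν : Measure Y} [IsProbabilityMeasure ν] {T : Y ≃ᵐ Y}

/-- Points at least as heavy as a given atom form a finite invariant set of positive, hence full,
measure. -/
theorem Ergodic.measure_singleton_eq_zero [MeasurableSingletonClass Y] (hT : Ergodic T ν)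
    (hY : IsInfiniteSystem ν) (y : Y) : ν {y} = 0 := by
  by_contra hy
  set P : Set Y := {z | ν {y} ≤ ν {z}}
  have hfin : P.Finite := Measure.finite_const_le_meas_of_disjoint_iUnion ν (pos_iff_ne_zero.2 hy)
    (fun z => measurableSet_singleton z) (fun a b hab => disjoint_singleton.2 hab)
    (measure_ne_top _ _)
  have hinv : T ⁻¹' P = P := by
    ext z
    have h : ν {T z} = ν {z} := by
      rw [← hT.measure_preimage (measurableSet_singleton (T z)).nullMeasurableSet]
      congr 1
      ext w
      simp
    simp only [P, mem_preimage, mem_ofPred_eq, h]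
  rcases hT.toPreErgodic.prob_eq_zero_or_one hfin.measurableSet hinv with h | h
  · exact hy (measure_mono_null (singleton_subset_iff.2 (by simp [P])) h)
  · exact hY P hfin h

/-- Closed balls around a point all of whose neighbourhoods are charged have positive measure and
shrink to a null singleton. -/
theorem exists_measurableSet_pos_lt [StandardBorelSpace Y] (h0 : ∀ y, ν {y} = 0) {ε : ℝ}
    (hε : 0 < ε) : ∃ A : Set Y, MeasurableSet A ∧ ν A ≠ 0 ∧ ν.real A < ε := by
  let := upgradeStandardBorel Y
  let := TopologicalSpace.upgradeIsCompletelyMetrizable Y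
  obtain ⟨y, -, hy⟩ := exists_mem_forall_mem_nhdsWithin_pos_measure (μ := ν) (s := univ) (by simp)
  have hpos : ∀ n : ℕ, ν (Metric.closedBall y (1 / ((n : ℝ) + 1))) ≠ 0 := fun n =>
    (hy _ (by rw [nhdsWithin_univ]; exact Metric.closedBall_mem_nhds y (by positivity))).ne'
  have hanti : Antitone fun n : ℕ => Metric.closedBall y (1 / ((n : ℝ) + 1)) := fun m n h =>
    Metric.closedBall_subset_closedBall (one_div_le_one_div_of_le (by positivity)
      (by exact_mod_cast Nat.succ_le_succ h))
  have hInter : ⋂ n : ℕ, Metric.closedBall y (1 / ((n : ℝ) + 1)) = {y} := by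
    ext z
    simp only [mem_iInter, Metric.mem_closedBall, mem_singleton_iff]
    refine ⟨fun h => dist_le_zero.1 (le_of_forall_pos_lt_add fun ε hε => ?_), ?_⟩
    · obtain ⟨n, hn⟩ := exists_nat_one_div_lt hε
      linarith [h n]
    · rintro rfl n
      rw [dist_self]
      positivity
  have hlim := tendsto_measure_iInter_atTop (μ := ν)
    (fun n : ℕ => (Metric.isClosed_closedBall (x := y)
      (ε := 1 / ((n : ℝ) + 1))).measurableSet.nullMeasurableSet) hanti ⟨0, measure_ne_top _ _⟩
  rw [hInter, h0] at hlim
  obtain ⟨n, hn⟩ := (hlim.eventually_lt_const (ENNReal.ofReal_pos.2 hε)).exists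
  exact ⟨_, Metric.isClosed_closedBall.measurableSet, hpos n,
    (ENNReal.lt_ofReal_iff_toReal_lt (measure_ne_top _ _)).1 hn⟩

theorem Ergodic.ae_exists_symm_iterate_mem (hT : Ergodic T ν) {A : Set Y} (hA : MeasurableSet A)
    (hA0 : ν A ≠ 0) : ∀ᵐ y ∂ν, ∃ n : ℕ, T.symm^[n] y ∈ A := by
  set W : Set Y := {y | ∃ n : ℕ, T.symm^[n] y ∈ A}
  have hW : MeasurableSet W := by
    have : W = ⋃ n : ℕ, T.symm^[n] ⁻¹' A := by
      ext y
      simp [W]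
    rw [this]
    exact MeasurableSet.iUnion fun n => (T.symm.measurable.iterate n) hA
  have hinv : T.symm ⁻¹' W ⊆ W := by
    rintro y ⟨n, hn⟩
    exact ⟨n + 1, by rwa [Function.iterate_succ_apply]⟩
  rcases hT.symm.ae_empty_or_univ_of_preimage_ae_le hW.nullMeasurableSet
    (ae_of_all _ hinv) with h | h
  · refine absurd (measure_mono_null (fun y hy => ?_) (ae_eq_empty.1 h)) hA0
    exact ⟨0, hy⟩
  · exact eventuallyEq_univ.1 h

/-- An infinite ergodic system carries a clock: a measurable `ℕ`-valued function that increases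
by one along the orbits, except on a set of small measure. -/
theorem Ergodic.exists_clock [StandardBorelSpace Y] (hT : Ergodic T ν) (hY : IsInfiniteSystem ν)
    {ε : ℝ} (hε : 0 < ε) :
    ∃ r : Y → ℕ, Measurable r ∧ ν.real {y | r (T y) ≠ r y + 1} < ε := by
  classical
  obtain ⟨A, hA, hA0, hAε⟩ := exists_measurableSet_pos_lt (hT.measure_singleton_eq_zero hY) hε
  -- The clock counts the steps back to the latest visit to `A`, so it can fail to advance only when
  -- `T y ∈ A`. The second alternative makes it `0` on the null set of points whose past misses `A`.
  let p : Y → ℕ → Prop := fun y n => T.symm^[n] y ∈ A ∨ ∀ k : ℕ, T.symm^[k] y ∉ A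
  have hp : ∀ y, ∃ n, p y n := by
    intro y
    by_cases h : ∃ n : ℕ, T.symm^[n] y ∈ A
    · exact h.imp fun n hn => Or.inl hn
    · exact ⟨0, Or.inr (not_exists.1 h)⟩
  have hm : ∀ k : ℕ, MeasurableSet {y | T.symm^[k] y ∈ A} := fun k => (T.symm.measurable.iterate k) hA
  have hpm : ∀ n, MeasurableSet {y | p y n} := by
    intro n
    have : {y | ∀ k : ℕ, T.symm^[k] y ∉ A} = ⋂ k : ℕ, {y | T.symm^[k] y ∈ A}ᶜ := by
      ext y
      simp
    have hnone : MeasurableSet {y | ∀ k : ℕ, T.symm^[k] y ∉ A} := by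
      rw [this]
      exact MeasurableSet.iInter fun k => (hm k).compl
    exact (hm n).union hnone
  refine ⟨fun y => Nat.find (hp y), measurable_find hp hpm, ?_⟩
  have hsub : ∀ᵐ y ∂ν, y ∈ {y | Nat.find (hp (T y)) ≠ Nat.find (hp y) + 1} → y ∈ T ⁻¹' A := by
    filter_upwards [hT.ae_exists_symm_iterate_mem hA hA0] with y hy
    intro hne
    by_contra hTy
    apply hne
    have hs : ∀ n : ℕ, T.symm^[n + 1] (T y) = T.symm^[n] y := fun n => by
      rw [Function.iterate_succ_apply, T.symm_apply_apply]
    have hy1 : ¬ ∀ k : ℕ, T.symm^[k] y ∉ A := fun h => hy.elim h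
    have hy2 : ¬ ∀ k : ℕ, T.symm^[k] (T y) ∉ A := by
      obtain ⟨n, hn⟩ := hy
      exact fun h => h (n + 1) (by rwa [hs])
    rw [Nat.find_eq_iff]
    have hspec := Nat.find_spec (hp y)
    refine ⟨Or.inl ?_, fun n hn => ?_⟩
    · rw [hs]
      exact hspec.resolve_right hy1
    · rintro (h | h)
      · rcases n with _ | n
        · exact hTy h
        · rw [hs] at h
          exact Nat.find_min (hp y) (Nat.lt_of_succ_lt_succ hn) (Or.inl h)
      · exact hy2 h
  calc ν.real _ ≤ ν.real (T ⁻¹' A) :=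
        ENNReal.toReal_mono (measure_ne_top _ _) (measure_mono_ae hsub)
    _ = ν.real A := hT.toMeasurePreserving.measureReal_preimage hA.nullMeasurableSet
    _ < ε := hAε

end Tower

/-! ### Almost invariant, almost equidistributed colourings. -/

section Coloring

variable {Y : Type*} [MeasurableSpace Y] {ν : Measure Y} [IsProbabilityMeasure ν] {S : Y → Y}

theorem MeasureTheory.MeasurePreserving.iterate_clock (hS : MeasurePreserving S ν ν) {r : Y → ℕ}
    (hr : Measurable r) {ε : ℝ} (h : ν.real {y | r (S y) ≠ r y + 1} ≤ ε) (n : ℕ) :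
    ν.real {y | r (S^[n] y) ≠ r y + n} ≤ n * ε := by
  induction n with
  | zero => simp
  | succ n ih =>
    have hm : MeasurableSet {y | r (S y) ≠ r y + 1} :=
      (measurableSet_eq_fun (hr.comp hS.measurable) (hr.add_const 1)).compl
    have hsub : {y | r (S^[n + 1] y) ≠ r y + (n + 1 : ℕ)} ⊆
        {y | r (S^[n] y) ≠ r y + n} ∪ S^[n] ⁻¹' {y | r (S y) ≠ r y + 1} := by
      intro y hy
      by_contra hcon
      simp only [mem_union, mem_preimage, mem_ofPred_eq, not_or, not_not] at hcon
      apply hy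
      rw [Function.iterate_succ_apply', hcon.2, hcon.1, add_assoc]
    calc ν.real _ ≤ ν.real _ := measureReal_mono hsub
      _ ≤ _ := measureReal_union_le _ _
      _ ≤ n * ε + ε := by
        gcongr
        rwa [(hS.iterate n).measureReal_preimage hm.nullMeasurableSet]
      _ = (n + 1 : ℕ) * ε := by push_cast; ring

theorem abs_measureReal_sub_le_of_imp {A B D : Set Y} (h : ∀ y ∉ D, y ∈ A ↔ y ∈ B) :
    |ν.real A - ν.real B| ≤ ν.real D := by
  have h1 : ν.real A ≤ ν.real B + ν.real D := by
    refine (measureReal_mono fun y hy => ?_).trans (measureReal_union_le B D)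
    by_cases hD : y ∈ D
    · exact Or.inr hD
    · exact Or.inl ((h y hD).1 hy)
  have h2 : ν.real B ≤ ν.real A + ν.real D := by
    refine (measureReal_mono fun y hy => ?_).trans (measureReal_union_le A D)
    by_cases hD : y ∈ D
    · exact Or.inr hD
    · exact Or.inl ((h y hD).2 hy)
  rw [abs_le]
  constructor <;> linarith

/-- If a `ZMod n`-valued function is shifted by one outside a set of small measure, then its
values are almost equidistributed. -/
theorem MeasureTheory.MeasurePreserving.abs_measureReal_fiber_sub_le
    (hS : MeasurePreserving S ν ν) {n : ℕ} [NeZero n] {c : Y → ZMod n}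
    (hc : ∀ j, MeasurableSet (c ⁻¹' {j})) {ε : ℝ} (h : ν.real {y | c (S y) ≠ c y + 1} ≤ ε)
    (j : ZMod n) : |ν.real (c ⁻¹' {j}) - 1 / n| ≤ n * ε := by
  have hstep : ∀ i : ZMod n, |ν.real (c ⁻¹' {i + 1}) - ν.real (c ⁻¹' {i})| ≤ ε := by
    intro i
    rw [← hS.measureReal_preimage (hc (i + 1)).nullMeasurableSet]
    refine (abs_measureReal_sub_le_of_imp fun y hy => ?_).trans h
    rw [mem_ofPred_eq, not_not] at hy
    simp [hy]
  have hiter : ∀ k : ℕ, |ν.real (c ⁻¹' {j + k}) - ν.real (c ⁻¹' {j})| ≤ k * ε := by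
    intro k
    induction k with
    | zero => simp
    | succ k ih =>
      have := hstep (j + k)
      push_cast
      rw [← add_assoc]
      calc _ ≤ _ := abs_sub_le _ (ν.real (c ⁻¹' {j + k})) _
        _ ≤ ε + k * ε := add_le_add this ih
        _ = _ := by ring
  have hε : 0 ≤ ε := measureReal_nonneg.trans h
  -- Any two residues are joined by fewer than `n` unit shifts, each costing `ε`.
  have hall : ∀ i : ZMod n, |ν.real (c ⁻¹' {i}) - ν.real (c ⁻¹' {j})| ≤ n * ε := by
    intro i
    have := hiter (i - j).val
    rw [ZMod.natCast_zmod_val, add_sub_cancel] at this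
    refine this.trans (mul_le_mul_of_nonneg_right ?_ hε)
    exact_mod_cast (ZMod.val_lt _).le
  have hsum : ∑ i : ZMod n, ν.real (c ⁻¹' {i}) = 1 := by
    rw [← measureReal_iUnion_fintype]
    · rw [← preimage_iUnion, iUnion_of_singleton, preimage_univ, probReal_univ]
    · exact fun a b hab => (disjoint_singleton.2 hab).preimage c
    · exact hc
  have hn : (0 : ℝ) < n := by exact_mod_cast Nat.pos_of_neZero n
  have hkey : |∑ i : ZMod n, (ν.real (c ⁻¹' {i}) - ν.real (c ⁻¹' {j}))| ≤ n * (n * ε) := by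
    refine (Finset.abs_sum_le_sum_abs _ _).trans ?_
    refine (Finset.sum_le_sum fun i _ => hall i).trans ?_
    rw [Finset.sum_const, Finset.card_univ, ZMod.card, nsmul_eq_mul]
  rw [Finset.sum_sub_distrib, hsum, Finset.sum_const, Finset.card_univ, ZMod.card, nsmul_eq_mul,
    abs_sub_comm] at hkey
  have h3 : ν.real (c ⁻¹' {j}) - 1 / n = (n * ν.real (c ⁻¹' {j}) - 1) / n := by
    field_simp
  rw [h3, abs_div, abs_of_pos hn, div_le_iff₀ hn]
  linarith

/-- There are measurable colourings by `ZMod K` that are asymptotically invariant and asymptotically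
equidistributed. -/
theorem Ergodic.exists_coloring_seq [StandardBorelSpace Y] {T : Y ≃ᵐ Y} (hT : Ergodic T ν)
    (hY : IsInfiniteSystem ν) (K : ℕ) [NeZero K] :
    ∃ κ : ℕ → Y → ZMod K, (∀ m j, MeasurableSet (κ m ⁻¹' {j})) ∧
      Tendsto (fun m => ν.real {y | κ m (T y) ≠ κ m y}) atTop (𝓝 0) ∧
      ∀ j, Tendsto (fun m => ν.real (κ m ⁻¹' {j})) atTop (𝓝 (1 / K)) := by
  have hmp := hT.toMeasurePreserving
  -- The error is quadratic because it will be multiplied by `m + 1`, either as the number of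
  -- residues or as the number of iterations.
  choose r hr hrε using fun m : ℕ =>
    hT.exists_clock hY (ε := 1 / ((m : ℝ) + 1) ^ 2) (by positivity)
  have hdiv : ∀ m j, MeasurableSet ((fun y => ((r m y / (m + 1) : ℕ) : ZMod K)) ⁻¹' {j}) :=
    fun m j => hr m (MeasurableSet.of_discrete
      (s := (fun k : ℕ => ((k / (m + 1) : ℕ) : ZMod K)) ⁻¹' {j}))
  have hmod : ∀ m j, MeasurableSet ((fun y => ((r m y : ℕ) : ZMod (m + 1))) ⁻¹' {j}) :=
    fun m j => hr m (MeasurableSet.of_discrete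
      (s := (fun k : ℕ => ((k : ℕ) : ZMod (m + 1))) ⁻¹' {j}))
  have hlim : Tendsto (fun m : ℕ => 1 / ((m : ℝ) + 1)) atTop (𝓝 0) :=
    tendsto_one_div_add_atTop_nhds_zero_nat
  have hsq : ∀ m : ℕ, 1 / ((m : ℝ) + 1) ^ 2 ≤ 1 / ((m : ℝ) + 1) := fun m =>
    one_div_le_one_div_of_le (by positivity) (by nlinarith [(Nat.cast_nonneg m : (0 : ℝ) ≤ m)])
  have hmul : ∀ m : ℕ, ((m + 1 : ℕ) : ℝ) * (1 / ((m : ℝ) + 1) ^ 2) = 1 / ((m : ℝ) + 1) := by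
    intro m
    push_cast
    field_simp
  -- Clock time is cut into blocks of length `m + 1`, coloured cyclically. The colour changes only
  -- if the clock fails or a block ends, that is, `r ≡ -1` modulo `m + 1`.
  refine ⟨fun m y => ((r m y / (m + 1) : ℕ) : ZMod K), hdiv, ?_, fun j => ?_⟩
  -- One unit is the frequency of block ends, one its error, and one bounds the clock failures.
  · refine squeeze_zero (g := fun m : ℕ => 3 * (1 / ((m : ℝ) + 1)))
      (fun m => measureReal_nonneg) (fun m => ?_) (by simpa using hlim.const_mul 3)
    have hcast : {y | ((r m (T y) : ℕ) : ZMod (m + 1)) ≠ ((r m y : ℕ) : ZMod (m + 1)) + 1} ⊆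
        {y | r m (T y) ≠ r m y + 1} := by
      intro y hy
      rw [mem_ofPred_eq] at hy ⊢
      exact fun h => hy (by rw [h]; push_cast; rfl)
    have hfib := hmp.abs_measureReal_fiber_sub_le (hmod m) (ε := 1 / ((m : ℝ) + 1) ^ 2)
      ((measureReal_mono hcast).trans (hrε m).le) (-1)
    rw [hmul, abs_le] at hfib
    have hsub : {y | ((r m (T y) / (m + 1) : ℕ) : ZMod K) ≠ ((r m y / (m + 1) : ℕ) : ZMod K)} ⊆
        {y | r m (T y) ≠ r m y + 1} ∪ (fun y => ((r m y : ℕ) : ZMod (m + 1))) ⁻¹' {-1} := by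
      intro y hy
      by_contra hcon
      simp only [mem_union, mem_preimage, mem_ofPred_eq, not_or, not_not, mem_singleton_iff] at hcon
      apply hy
      rw [hcon.1, Nat.succ_div_of_not_dvd]
      intro hd
      apply hcon.2
      rw [eq_neg_iff_add_eq_zero]
      exact_mod_cast (ZMod.natCast_eq_zero_iff _ _).2 hd
    have h1 := (measureReal_mono (μ := ν) hsub).trans (measureReal_union_le _ _)
    have h2 := hrε m
    have h3 := hsq m
    push_cast at hfib
    linarith [hfib.2]
  · rw [tendsto_iff_norm_sub_tendsto_zero]
    refine squeeze_zero (g := fun m : ℕ => (K : ℝ) * (1 / ((m : ℝ) + 1)))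
      (fun m => norm_nonneg _) (fun m => ?_) (by simpa using hlim.const_mul (K : ℝ))
    have hit := hmp.iterate_clock (hr m) (hrε m).le (m + 1)
    rw [hmul] at hit
    -- The iterate by a whole block length shifts the colour by one off a small set.
    refine (hmp.iterate (m + 1)).abs_measureReal_fiber_sub_le (hdiv m) ?_ j
    refine (measureReal_mono fun y hy => ?_).trans hit
    rw [mem_ofPred_eq] at hy ⊢
    refine fun h => hy ?_
    rw [h, Nat.add_div_right _ (Nat.succ_pos m)]
    push_cast
    rfl

end Coloring

/-! ### Averaging over group translates. -/

section Translates

variable {G : Type*} [Group G] [MeasurableSpace G] [MeasurableMul₂ G] {lam : Measure G}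
  [IsProbabilityMeasure lam]

/-- Averaged over `x`, the cross term `∫ Q(g) D(xg)` vanishes by right invariance and `∫ D = 0`, so
some `x` makes it nonpositive. Left invariance preserves the square norm of `D`. -/
theorem exists_integral_sq_add_translate_le [lam.IsMulLeftInvariant] [lam.IsMulRightInvariant]
    {D Q : G → ℝ} (hD : Measurable D) (hQ : Measurable Q) {C C' : ℝ} (hDC : ∀ g, |D g| ≤ C)
    (hQC : ∀ g, |Q g| ≤ C') (h0 : ∫ g, D g ∂lam = 0) :
    ∃ x : G, ∫ g, (Q g + D (x * g)) ^ 2 ∂lam ≤ ∫ g, Q g ^ 2 ∂lam + ∫ g, D g ^ 2 ∂lam := by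
  have hC0 : 0 ≤ C := (abs_nonneg _).trans (hDC 1)
  have hC0' : 0 ≤ C' := (abs_nonneg _).trans (hQC 1)
  have hmix : Measurable fun p : G × G => Q p.2 * D (p.1 * p.2) :=
    (hQ.comp measurable_snd).mul (hD.comp measurable_mul)
  have hbd : ∀ x g, |Q g * D (x * g)| ≤ C' * C := fun x g => by
    rw [abs_mul]
    exact mul_le_mul (hQC g) (hDC _) (abs_nonneg _) hC0'
  have hmi : Integrable (fun p : G × G => Q p.2 * D (p.1 * p.2)) (lam.prod lam) :=
    integrable_of_abs_le hmix fun p => hbd p.1 p.2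
  obtain ⟨x, hx⟩ := exists_le_integral hmi.integral_prod_left
  have hzero : ∫ x, ∫ g, Q g * D (x * g) ∂lam ∂lam = 0 := by
    rw [integral_integral_swap hmi]
    simp_rw [integral_const_mul, integral_mul_right_eq_self, h0, mul_zero, integral_zero]
  rw [hzero] at hx
  refine ⟨x, ?_⟩
  have hDx : Measurable fun g => D (x * g) := hD.comp (measurable_const_mul x)
  have i1 : Integrable (fun g => Q g ^ 2) lam :=
    integrable_of_abs_le (C := C' ^ 2) (hQ.pow_const 2) fun g => by
      rw [abs_pow]
      exact pow_le_pow_left₀ (abs_nonneg _) (hQC g) 2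
  have i2 : Integrable (fun g => 2 * (Q g * D (x * g))) lam :=
    (integrable_of_abs_le (hQ.mul hDx) fun g => hbd x g).const_mul 2
  have i3 : Integrable (fun g => D (x * g) ^ 2) lam :=
    integrable_of_abs_le (C := C ^ 2) (hDx.pow_const 2) fun g => by
      rw [abs_pow]
      exact pow_le_pow_left₀ (abs_nonneg _) (hDC _) 2
  have hexp : ∀ g, (Q g + D (x * g)) ^ 2 = Q g ^ 2 + 2 * (Q g * D (x * g)) + D (x * g) ^ 2 :=
    fun g => by ring
  simp_rw [hexp]
  rw [integral_add (f := fun g => Q g ^ 2 + 2 * (Q g * D (x * g))) (i1.add i2) i3,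
    integral_add i1 i2, integral_const_mul,
    integral_mul_left_eq_self (fun g => D g ^ 2) x]
  linarith

/-- Greedy choice of translates: the square norm grows only linearly in their number, so that of the
average decays like its inverse. -/
theorem exists_integral_sq_sum_translates_le [lam.IsMulLeftInvariant] [lam.IsMulRightInvariant]
    {D : G → ℝ} (hD : Measurable D) {C : ℝ} (hDC : ∀ g, |D g| ≤ C) (h0 : ∫ g, D g ∂lam = 0)
    {ι : Type*} (s : Finset ι) :
    ∃ x : ι → G, ∫ g, (∑ i ∈ s, D (x i * g)) ^ 2 ∂lam ≤ s.card * ∫ g, D g ^ 2 ∂lam := by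
  classical
  induction s using Finset.induction_on with
  | empty => exact ⟨fun _ => 1, by simp⟩
  | insert a s ha ih =>
    obtain ⟨x, hx⟩ := ih
    obtain ⟨y, hy⟩ := exists_integral_sq_add_translate_le (lam := lam) hD
      (Q := fun g => ∑ i ∈ s, D (x i * g))
      (Finset.measurable_fun_sum _ fun i _ => hD.comp (measurable_const_mul (x i))) hDC
      (C' := s.card * C) (fun g => by
        refine (Finset.abs_sum_le_sum_abs _ _).trans ?_
        refine (Finset.sum_le_sum fun i _ => hDC _).trans ?_
        rw [Finset.sum_const, nsmul_eq_mul]) h0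
    refine ⟨Function.update x a y, ?_⟩
    have hsum : ∀ g, ∑ i ∈ insert a s, D (Function.update x a y i * g) =
        ∑ i ∈ s, D (x i * g) + D (y * g) := by
      intro g
      rw [Finset.sum_insert ha, Function.update_self, add_comm]
      congr 1
      refine Finset.sum_congr rfl fun i hi => ?_
      rw [Function.update_of_ne (ne_of_mem_of_not_mem hi ha)]
    simp_rw [hsum]
    rw [Finset.card_insert_of_notMem ha]
    push_cast
    linarith

theorem integral_abs_le_of_integral_sq_le {X : Type*} [MeasurableSpace X] {μ : Measure X}
    [IsProbabilityMeasure μ] {v : X → ℝ} (hv : Measurable v) {C : ℝ} (hC : ∀ x, |v x| ≤ C) {a : ℝ}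
    (ha : 0 < a) (h : ∫ x, v x ^ 2 ∂μ ≤ a ^ 2) : ∫ x, |v x| ∂μ ≤ a := by
  have i2 : Integrable (fun x => v x ^ 2) μ :=
    integrable_of_abs_le (C := C ^ 2) (hv.pow_const 2) fun g => by
      rw [abs_pow]
      exact pow_le_pow_left₀ (abs_nonneg _) (hC _) 2
  -- The inequality of arithmetic and geometric means, tuned to `a`, stands in for Cauchy–Schwarz.
  have hle : ∀ x, |v x| ≤ (2 * a)⁻¹ * v x ^ 2 + a / 2 := by
    intro x
    have h1 : 0 ≤ (2 * a)⁻¹ * (|v x| - a) ^ 2 := by positivity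
    have h2 : (2 * a)⁻¹ * (|v x| - a) ^ 2 = (2 * a)⁻¹ * v x ^ 2 + a / 2 - |v x| := by
      rw [← sq_abs (v x)]
      field_simp
      ring
    linarith
  calc ∫ x, |v x| ∂μ ≤ ∫ x, ((2 * a)⁻¹ * v x ^ 2 + a / 2) ∂μ :=
        integral_mono (integrable_of_abs_le hv hC).abs
          ((i2.const_mul _).add (integrable_const _)) hle
    _ = (2 * a)⁻¹ * ∫ x, v x ^ 2 ∂μ + a / 2 := by
        rw [integral_add (i2.const_mul _) (integrable_const _), integral_const_mul]
        simp
    _ ≤ (2 * a)⁻¹ * a ^ 2 + a / 2 := by gcongr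
    _ = a := by field_simp; ring

/-- Averages of finitely many translates of a bounded function approximate its integral in `L¹`. -/
theorem exists_integral_abs_average_translates_sub_lt [lam.IsMulLeftInvariant]
    [lam.IsMulRightInvariant] {F : G → ℝ} (hF : Measurable F) {C : ℝ} (hC : ∀ g, |F g| ≤ C)
    {δ : ℝ} (hδ : 0 < δ) :
    ∃ (K : ℕ) (_ : NeZero K) (x : ZMod K → G),
      ∫ g, |∑ j, 1 / K * F (x j * g) - ∫ h, F h ∂lam| ∂lam < δ := by
  set c := ∫ h, F h ∂lam
  set D : G → ℝ := fun g => F g - c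
  have hD : Measurable D := hF.sub_const c
  have hDC : ∀ g, |D g| ≤ C + |c| := fun g => (abs_sub _ _).trans (add_le_add_left (hC g) _)
  have h0 : ∫ g, D g ∂lam = 0 := by
    rw [integral_sub (integrable_of_abs_le hF hC) (integrable_const c)]
    simp [c]
  set V := ∫ g, D g ^ 2 ∂lam
  obtain ⟨n, hn⟩ := exists_nat_gt (V / (δ / 2) ^ 2)
  have hV : V < (n + 1 : ℕ) * (δ / 2) ^ 2 := by
    rw [div_lt_iff₀ (by positivity)] at hn
    push_cast
    nlinarith [sq_nonneg (δ / 2)]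
  obtain ⟨x, hx⟩ := exists_integral_sq_sum_translates_le (lam := lam) hD hDC h0
    (Finset.univ : Finset (ZMod (n + 1)))
  refine ⟨n + 1, inferInstance, x, ?_⟩
  have hK : (0 : ℝ) < (n + 1 : ℕ) := by positivity
  have heq : ∀ g, ∑ j, 1 / ((n + 1 : ℕ) : ℝ) * F (x j * g) - c =
      1 / ((n + 1 : ℕ) : ℝ) * ∑ j, D (x j * g) := by
    intro g
    simp only [D]
    rw [Finset.sum_sub_distrib, Finset.sum_const, Finset.card_univ, ZMod.card, nsmul_eq_mul, mul_sub,
      Finset.mul_sum, one_div, inv_mul_cancel_left₀ hK.ne']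
  simp_rw [heq]
  rw [Finset.card_univ, ZMod.card] at hx
  refine lt_of_le_of_lt (integral_abs_le_of_integral_sq_le
    (C := 1 / ((n + 1 : ℕ) : ℝ) * ((n + 1 : ℕ) * (C + |c|))) ?_ (fun g => ?_) (half_pos hδ) ?_)
    (half_lt_self hδ)
  · exact (Finset.measurable_fun_sum _ fun j _ => hD.comp (measurable_const_mul (x j))).const_mul _
  · rw [abs_mul, abs_of_pos (one_div_pos.2 hK)]
    refine mul_le_mul_of_nonneg_left ?_ (one_div_pos.2 hK).le
    refine (Finset.abs_sum_le_sum_abs _ _).trans ?_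
    refine (Finset.sum_le_sum fun i _ => hDC _).trans ?_
    rw [Finset.sum_const, nsmul_eq_mul, Finset.card_univ, ZMod.card]
  · simp_rw [mul_pow]
    rw [integral_const_mul]
    calc (1 / ((n + 1 : ℕ) : ℝ)) ^ 2 * ∫ g, (∑ j, D (x j * g)) ^ 2 ∂lam
        ≤ (1 / ((n + 1 : ℕ) : ℝ)) ^ 2 * ((n + 1 : ℕ) * ((n + 1 : ℕ) * (δ / 2) ^ 2)) := by
          refine mul_le_mul_of_nonneg_left (hx.trans ?_) (by positivity)
          exact mul_le_mul_of_nonneg_left hV.le hK.le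
      _ = (δ / 2) ^ 2 := by field_simp

end Translates

/-! ### Ergodic averages along coboundaries. -/

theorem birkhoffAverage_skewProduct_coboundary {Y G : Type*} [Group G]
    (T : Y → Y) (b : Y → G) (f : Y × G → ℝ) (N : ℕ)
    (y : Y) (g : G) :
    birkhoffAverage ℝ (skewProduct T fun y => b (T y) * (b y)⁻¹) f N (y, b y * g) =
      birkhoffAverage ℝ T (fun z => f (z, b z * g)) N y := by
  have hiter : ∀ n : ℕ, (skewProduct T fun y => b (T y) * (b y)⁻¹)^[n] (y, b y * g) =
      (T^[n] y, b (T^[n] y) * g) := by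
    intro n
    induction n with
    | zero => rfl
    | succ n ih =>
      rw [Function.iterate_succ_apply', ih, Function.iterate_succ_apply']
      simp [skewProduct, mul_assoc]
  simp only [birkhoffAverage_eq_sum, hiter]

theorem integral_eq_sum_setIntegral_fiber {Y : Type*} [MeasurableSpace Y] {ν : Measure Y}
    {ι : Type*} [Fintype ι] {κ : Y → ι}
    (hκ : ∀ j, MeasurableSet (κ ⁻¹' {j})) {u : Y → ℝ} (hu : Integrable u ν) :
    ∫ y, u y ∂ν = ∑ j, ∫ y in κ ⁻¹' {j}, u y ∂ν := by
  have h := integral_iUnion hκ (fun a b hab => (disjoint_singleton.2 hab).preimage κ)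
    (f := u) (μ := ν) hu.integrableOn
  rwa [← preimage_iUnion, iUnion_of_singleton, preimage_univ, setIntegral_univ, tsum_fintype] at h

section Coboundary

variable {Y : Type*} [MeasurableSpace Y] {ν : Measure Y} [IsProbabilityMeasure ν]
  {G : Type*} [Group G] [MeasurableSpace G] [MeasurableMul₂ G] {lam : Measure G}
  [IsProbabilityMeasure lam]

theorem measurePreserving_skew [lam.IsMulLeftInvariant] {T : Y → Y} (hT : MeasurePreserving T ν ν)
    {b : Y → G} (hb : Measurable b) :
    MeasurePreserving (skewProduct T b) (ν.prod lam) (ν.prod lam) :=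
  hT.skew_product (g := fun y g => b y * g)
    ((hb.comp measurable_fst).mul measurable_snd) (ae_of_all _ fun y => map_mul_left_eq_self lam (b y))

/-- Turns `L¹` convergence of `v` to a constant `a` into convergence of `∫ |v - c|` to `|a - c|`. -/
theorem abs_integral_abs_sub_sub_le {X : Type*} [MeasurableSpace X] {μ : Measure X}
    [IsProbabilityMeasure μ] {v : X → ℝ} (hv : Integrable v μ) (a c : ℝ) :
    |(∫ x, |v x - c| ∂μ) - (|a - c|)| ≤ ∫ x, |v x - a| ∂μ := by
  have i1 : Integrable (fun x => |v x - c|) μ := (hv.sub (integrable_const c)).abs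
  have i2 : Integrable (fun x => |v x - a|) μ := (hv.sub (integrable_const a)).abs
  have h : ∫ x, (|v x - c| - |a - c|) ∂μ = ∫ x, |v x - c| ∂μ - |a - c| := by
    rw [integral_sub i1 (integrable_const _)]
    simp
  rw [← h]
  refine abs_integral_le_integral_abs.trans ?_
  refine integral_mono (i1.sub (integrable_const _)).abs i2 fun x => ?_
  refine (abs_abs_sub_abs_le_abs_sub _ _).trans (le_of_eq ?_)
  congr 1
  ring

/-- The limit of the ergodic averages along a coboundary. -/
theorem Ergodic.tendsto_integral_abs_birkhoffAverage_coboundary_sub [MeasurableInv G]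
    [lam.IsMulLeftInvariant] {T : Y → Y} (hT : Ergodic T ν) {b : Y → G} (hb : Measurable b)
    {f : Y × G → ℝ} (hf : Measurable f) {C : ℝ} (hC : ∀ p, |f p| ≤ C) (c : ℝ) :
    Tendsto (fun N => ∫ p, |birkhoffAverage ℝ (skewProduct T fun y => b (T y) * (b y)⁻¹) f N p - c|
      ∂(ν.prod lam)) atTop (𝓝 (∫ g, |∫ y, f (y, b y * g) ∂ν - c| ∂lam)) := by
  have hmp := hT.toMeasurePreserving
  have hTm := hmp.measurable
  have hsk : Measurable (skewProduct T fun y => b (T y) * (b y)⁻¹) :=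
    (hTm.comp measurable_fst).prodMk
      ((((hb.comp hTm).mul hb.inv).comp measurable_fst).mul measurable_snd)
  have hid : MeasurePreserving (skewProduct _root_.id b) (ν.prod lam) (ν.prod lam) :=
    measurePreserving_skew (MeasurePreserving.id ν) hb
  have havm : ∀ N, Measurable fun p : Y × G =>
      |birkhoffAverage ℝ (skewProduct T fun y => b (T y) * (b y)⁻¹) f N p - c| :=
    fun N => ((hf.birkhoffAverage hsk N).sub_const c).abs
  have hm : ∀ N, Measurable fun p : Y × G =>
      |birkhoffAverage ℝ T (fun z => f (z, b z * p.2)) N p.1 - c| := by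
    intro N
    have := (havm N).comp hid.measurable
    convert this using 2 with p
    simp only [Function.comp, skewProduct, _root_.id, birkhoffAverage_skewProduct_coboundary]
  have hfg : ∀ g, Measurable fun y => f (y, b y * g) := fun g =>
    hf.comp (measurable_id.prodMk (hb.mul_const g))
  have hbd : ∀ N (p : Y × G), |(|birkhoffAverage ℝ T (fun z => f (z, b z * p.2)) N p.1 - c|)| ≤
      C + |c| := fun N p => by
    rw [abs_abs]
    exact (abs_sub _ _).trans (add_le_add_left (abs_birkhoffAverage_le (fun z => hC _) N _) _)
  have heq : ∀ N, ∫ p, |birkhoffAverage ℝ (skewProduct T fun y => b (T y) * (b y)⁻¹) f N p - c|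
      ∂(ν.prod lam) = ∫ g, ∫ y, |birkhoffAverage ℝ T (fun z => f (z, b z * g)) N y - c| ∂ν ∂lam := by
    intro N
    rw [← hid.integral_comp_eq (havm N).aestronglyMeasurable]
    have := integral_prod_symm _ (integrable_of_abs_le (μ := ν.prod lam) (hm N) (hbd N))
    rw [← this]
    refine integral_congr_ae (ae_of_all _ fun p => ?_)
    simp only [skewProduct, _root_.id, birkhoffAverage_skewProduct_coboundary]
  simp_rw [heq]
  -- After the conjugation, `g` is a mere parameter: the mean ergodic theorem for `T` applies to
  -- each `g` separately.
  refine tendsto_integral_of_dominated_convergence (fun _ => C + |c|) (fun N => ?_)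
    (integrable_const _) (fun N => ae_of_all _ fun g => ?_) (ae_of_all _ fun g => ?_)
  · exact ((hm N).stronglyMeasurable.integral_prod_left').aestronglyMeasurable
  · refine (norm_integral_le_of_norm_le_const (ae_of_all _ fun y => hbd N (y, g))).trans ?_
    simp
  · rw [tendsto_iff_norm_sub_tendsto_zero]
    refine squeeze_zero (fun N => norm_nonneg _) (fun N => ?_)
      (hT.tendsto_integral_abs_birkhoffAverage_sub (hfg g) fun y => hC _)
    exact abs_integral_abs_sub_sub_le
      ((integrable_of_abs_le (hfg g) fun y => hC _).birkhoffAverage hmp N) _ c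

/-- Twisting by an asymptotically invariant and equidistributed colouring averages the fibre
integrals over the translates attached to the colours. -/
theorem Ergodic.tendsto_integral_abs_coloring_sub {T : Y → Y} (hT : Ergodic T ν) {K : ℕ} [NeZero K]
    {κ : ℕ → Y → ZMod K} (hκ : ∀ m j, MeasurableSet (κ m ⁻¹' {j}))
    (hinv : Tendsto (fun m => ν.real {y | κ m (T y) ≠ κ m y}) atTop (𝓝 0))
    (hequi : ∀ j, Tendsto (fun m => ν.real (κ m ⁻¹' {j})) atTop (𝓝 (1 / K)))
    (x : ZMod K → G) {f : Y × G → ℝ} (hf : Measurable f) {C : ℝ} (hC : ∀ p, |f p| ≤ C) (c : ℝ) :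
    Tendsto (fun m => ∫ g, |∫ y, f (y, x (κ m y) * g) ∂ν - c| ∂lam) atTop
      (𝓝 (∫ g, |∑ j, 1 / K * ∫ y, f (y, x j * g) ∂ν - c| ∂lam)) := by
  have hfg : ∀ g, Measurable fun y => f (y, g) := fun g => hf.comp (measurable_id.prodMk measurable_const)
  have hxκ : ∀ m, Measurable fun y => x (κ m y) := by
    intro m s _
    have : (fun y => x (κ m y)) ⁻¹' s = ⋃ j ∈ x ⁻¹' s, κ m ⁻¹' {j} := by
      ext y
      simp
    rw [this]
    exact MeasurableSet.biUnion (to_countable _) fun j _ => hκ m j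
  have hfx : ∀ m, Measurable fun p : Y × G => f (p.1, x (κ m p.1) * p.2) := fun m =>
    hf.comp (measurable_fst.prodMk (((hxκ m).comp measurable_fst).mul measurable_snd))
  refine tendsto_integral_of_dominated_convergence (fun _ => C + |c|) (fun m => ?_)
    (integrable_const _) (fun m => ae_of_all _ fun g => ?_) (ae_of_all _ fun g => ?_)
  · have h : Measurable fun g => ∫ y, f (y, x (κ m y) * g) ∂ν :=
      ((hfx m).stronglyMeasurable.integral_prod_left').measurable
    exact (h.sub_const c).abs.aestronglyMeasurable
  · rw [Real.norm_eq_abs, abs_abs]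
    refine (abs_sub _ _).trans (add_le_add_left ?_ _)
    have hb : ∀ y, ‖f (y, x (κ m y) * g)‖ ≤ C := fun y => hC _
    refine (norm_integral_le_of_norm_le_const (ae_of_all _ hb)).trans ?_
    simp
  · refine ((Tendsto.sub_const ?_ c).abs)
    -- On each colour class the translate is constant, and the class is asymptotically independent
    -- of `f (·, x j * g)`.
    have hdec : ∀ m, ∫ y, f (y, x (κ m y) * g) ∂ν =
        ∑ j, ∫ y in κ m ⁻¹' {j}, f (y, x j * g) ∂ν := by
      intro m
      have hfxm : Measurable fun y => f (y, x (κ m y) * g) :=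
        (hfx m).comp (measurable_id.prodMk (measurable_const (a := g)))
      rw [integral_eq_sum_setIntegral_fiber (hκ m) (integrable_of_abs_le hfxm fun y => hC _)]
      refine Finset.sum_congr rfl fun j _ => setIntegral_congr_fun (hκ m j) fun y hy => ?_
      have hy' : κ m y = j := hy
      simp only [hy']
    simp_rw [hdec]
    refine tendsto_finsetSum _ fun j _ =>
      hT.tendsto_setIntegral_of_asymptoticallyInvariant (hfg _) (fun y => hC _) (fun m => hκ m j)
        (squeeze_zero (fun m => measureReal_nonneg) (fun m => measureReal_mono ?_) hinv) (hequi j)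
    intro y hy h
    simp only [mem_symmDiff, mem_preimage, mem_singleton_iff] at hy
    rw [h] at hy
    tauto

end Coboundary

/-! ### Density of cocycles with nearly constant averages. -/

section Density

variable {Y : Type*} [MeasurableSpace Y] {ν : Measure Y} [IsProbabilityMeasure ν]
  {G : Type*} [Group G] [MeasurableSpace G] [MeasurableMul₂ G]

/-- The product `φ (T⁻¹ y) ⋯ φ (T⁻ⁿ y)` of a cocycle along the past of `y`. -/
def pastProduct (T : Y ≃ᵐ Y) (φ : Y → G) : ℕ → Y → G
  | 0, _ => 1
  | n + 1, y => φ (T.symm y) * pastProduct T φ n (T.symm y)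

theorem measurable_pastProduct (T : Y ≃ᵐ Y) {φ : Y → G} (hφ : Measurable φ) :
    ∀ n, Measurable (pastProduct T φ n)
  | 0 => measurable_const
  | n + 1 => (hφ.comp T.symm.measurable).mul
      ((measurable_pastProduct T hφ n).comp T.symm.measurable)

/-- Coboundaries are dense. -/
theorem Ergodic.exists_coboundary_eq_off_small [MeasurableInv G] [StandardBorelSpace Y] {T : Y ≃ᵐ Y}
    (hT : Ergodic T ν) (hY : IsInfiniteSystem ν) {φ : Y → G} (hφ : Measurable φ) {ε : ℝ}
    (hε : 0 < ε) :
    ∃ b : Y → G, Measurable b ∧ ν.real {y | b (T y) * (b y)⁻¹ ≠ φ y} < ε := by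
  obtain ⟨r, hr, hrε⟩ := hT.exists_clock hY hε
  -- Where the clock advances by one, the past product gains exactly the factor `φ y` on the left.
  refine ⟨fun y => pastProduct T φ (r y) y, ?_, lt_of_le_of_lt (measureReal_mono ?_) hrε⟩
  · exact (measurable_from_prod_countable_right (f := fun p : ℕ × Y => pastProduct T φ p.1 p.2)
      (measurable_pastProduct T hφ)).comp (hr.prodMk measurable_id)
  · intro y hy
    rw [mem_ofPred_eq] at hy ⊢
    intro h
    apply hy
    simp only
    rw [h, pastProduct, T.symm_apply_apply, mul_inv_cancel_right]

/-- Every cocycle is approximated by coboundaries along which the ergodic averages of a given bounded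
function are almost constant. -/
theorem Ergodic.exists_coboundary_birkhoffAverage_lt [MeasurableInv G] [StandardBorelSpace Y] {T : Y ≃ᵐ Y}
    (hT : Ergodic T ν) (hY : IsInfiniteSystem ν) {lam : Measure G} [IsProbabilityMeasure lam]
    [lam.IsMulLeftInvariant] [lam.IsMulRightInvariant] {φ : Y → G} (hφ : Measurable φ)
    {f : Y × G → ℝ} (hf : Measurable f) {C : ℝ} (hC : ∀ p, |f p| ≤ C) {ε δ : ℝ} (hε : 0 < ε)
    (hδ : 0 < δ) :
    ∃ b : Y → G, Measurable b ∧ ν.real {y | b (T y) * (b y)⁻¹ ≠ φ y} < ε ∧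
      ∃ N, N ≠ 0 ∧ ∫ p, |birkhoffAverage ℝ (skewProduct T fun y => b (T y) * (b y)⁻¹) f N p -
        ∫ q, f q ∂(ν.prod lam)| ∂(ν.prod lam) < δ := by
  obtain ⟨b₀, hb₀, hb₀ε⟩ := hT.exists_coboundary_eq_off_small hY hφ (half_pos hε)
  have hid : MeasurePreserving (skewProduct _root_.id b₀) (ν.prod lam) (ν.prod lam) :=
    measurePreserving_skew (MeasurePreserving.id ν) hb₀
  set f' : Y × G → ℝ := fun p => f (skewProduct _root_.id b₀ p)
  have hf' : Measurable f' := hf.comp hid.measurable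
  have hC' : ∀ p, |f' p| ≤ C := fun p => hC _
  set c := ∫ q, f q ∂(ν.prod lam)
  set F : G → ℝ := fun g => ∫ y, f' (y, g) ∂ν
  have hF : Measurable F := hf'.stronglyMeasurable.integral_prod_left'.measurable
  have hFC : ∀ g, |F g| ≤ C := by
    intro g
    have hb : ∀ y, ‖f' (y, g)‖ ≤ C := fun y => hC' _
    refine (norm_integral_le_of_norm_le_const (ae_of_all _ hb)).trans ?_
    simp
  have hFc : ∫ g, F g ∂lam = c := by
    rw [← integral_prod_symm _ (integrable_of_abs_le (μ := ν.prod lam) hf' hC')]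
    exact hid.integral_comp_eq hf.aestronglyMeasurable
  obtain ⟨K, hK, x, hx⟩ := exists_integral_abs_average_translates_sub_lt (lam := lam) hF hFC hδ
  rw [hFc] at hx
  obtain ⟨κ, hκ, hinv, hequi⟩ := hT.exists_coloring_seq hY K
  obtain ⟨m, hm1, hm2⟩ := (((hT.tendsto_integral_abs_coloring_sub (lam := lam) hκ hinv hequi x hf' hC'
    c).eventually_lt_const hx).and (hinv.eventually_lt_const (half_pos hε))).exists
  have hxκ : Measurable fun y => x (κ m y) := by
    intro s _
    have : (fun y => x (κ m y)) ⁻¹' s = ⋃ j ∈ x ⁻¹' s, κ m ⁻¹' {j} := by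
      ext y
      simp
    rw [this]
    exact MeasurableSet.biUnion (to_countable _) fun j _ => hκ m j
  have hb : Measurable fun y => b₀ y * x (κ m y) := hb₀.mul hxκ
  -- With the colour factor on the right of `b₀`, it cancels in the coboundary wherever `T`
  -- preserves the colour.
  refine ⟨fun y => b₀ y * x (κ m y), hb, ?_, ?_⟩
  · calc ν.real {y | b₀ (T y) * x (κ m (T y)) * (b₀ y * x (κ m y))⁻¹ ≠ φ y}
        ≤ ν.real ({y | b₀ (T y) * (b₀ y)⁻¹ ≠ φ y} ∪ {y | κ m (T y) ≠ κ m y}) := by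
          refine measureReal_mono fun y hy => ?_
          by_contra hcon
          simp only [mem_union, mem_ofPred_eq, not_or, not_not] at hcon hy
          apply hy
          rw [hcon.2, mul_inv_rev, mul_assoc, mul_inv_cancel_left, hcon.1]
      _ ≤ _ := measureReal_union_le _ _
      _ < ε / 2 + ε / 2 := add_lt_add hb₀ε hm2
      _ = ε := add_halves ε
  · refine ((eventually_ne_atTop 0).and
      ((hT.tendsto_integral_abs_birkhoffAverage_coboundary_sub (lam := lam) hb hf hC
        c).eventually_lt_const ?_)).exists
    simpa only [f', skewProduct, _root_.id, mul_assoc] using hm1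

end Density

/-! ### Test functions, an ergodicity criterion and continuity in the cocycle. -/

theorem CocycleSpace.measurable_rep {Y : Type*} [MeasurableSpace Y] {ν : Measure Y} {G : Type*}
    [MetricSpace G] [MeasurableSpace G] [BorelSpace G] (φ : CocycleSpace ν G) : Measurable φ.rep :=
  φ.stronglyMeasurable_rep.measurable

theorem skewProduct_iterate_fst {Y G : Type*} [Mul G] (T : Y → Y) (φ : Y → G) (p : Y × G) (n : ℕ) :
    ((skewProduct T φ)^[n] p).1 = T^[n] p.1 := by
  induction n with
  | zero => rfl
  | succ n ih => rw [Function.iterate_succ_apply', Function.iterate_succ_apply', ← ih]; rfl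

theorem skewProduct_iterate_congr {Y G : Type*} [Mul G] {T : Y → Y} {u v : Y → G} {p : Y × G}
    (h : ∀ i : ℕ, u (T^[i] p.1) = v (T^[i] p.1)) (n : ℕ) :
    (skewProduct T u)^[n] p = (skewProduct T v)^[n] p := by
  induction n with
  | zero => rfl
  | succ n ih =>
    rw [Function.iterate_succ_apply', Function.iterate_succ_apply', ih]
    simp only [skewProduct, skewProduct_iterate_fst, h n]

theorem birkhoffAverage_skewProduct_congr_ae {Y G : Type*} [Mul G] [MeasurableSpace Y]
    [MeasurableSpace G] {ν : Measure Y} {lam : Measure G} [SFinite lam] {T : Y → Y}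
    (hT : MeasurePreserving T ν ν) {u v : Y → G} (h : u =ᵐ[ν] v) (f : Y × G → ℝ) (N : ℕ) :
    birkhoffAverage ℝ (skewProduct T u) f N =ᵐ[ν.prod lam]
      birkhoffAverage ℝ (skewProduct T v) f N := by
  have hae : ∀ᵐ y ∂ν, ∀ i : ℕ, u (T^[i] y) = v (T^[i] y) :=
    ae_all_iff.2 fun i => (hT.iterate i).quasiMeasurePreserving.ae h
  filter_upwards [Measure.quasiMeasurePreserving_fst.ae hae] with p hp
  simp only [birkhoffAverage_eq_sum, skewProduct_iterate_congr hp]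

/-- A countable family of bounded functions, continuous in the second variable, that approximates
all indicators of measurable sets in `L¹`. -/
theorem exists_seq_bounded_approx_indicator {Y : Type*} [MeasurableSpace Y]
    {G : Type*} [MetricSpace G] [MeasurableSpace G] [BorelSpace G] [SecondCountableTopology G]
    [StandardBorelSpace Y] (μ : Measure (Y × G))
    [IsFiniteMeasure μ] :
    ∃ (ι : Type) (_ : Countable ι) (f : ι → Y × G → ℝ), (∀ j, Measurable (f j)) ∧
      (∀ j y, Continuous fun g => f j (y, g)) ∧ (∀ j, ∃ C, ∀ p, |f j p| ≤ C) ∧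
      ∀ s, MeasurableSet s → ∀ ε > 0, ∃ j, ∫ p, |s.indicator 1 p - f j p| ∂μ < ε := by
  -- An auxiliary Polish topology on `Y` makes bounded continuous functions on `Y × G` dense in
  -- `L¹`.
  let := upgradeStandardBorel Y
  let := TopologicalSpace.upgradeIsCompletelyMetrizable Y
  obtain ⟨𝒜, h𝒜c, h𝒜⟩ := exists_countable_measureDense μ
  have hi : ∀ s : Set (Y × G), MeasurableSet s → Integrable (s.indicator (1 : Y × G → ℝ)) μ :=
    fun s hs => (integrable_const (1 : ℝ)).indicator hs
  have hex : ∀ (t : Set (Y × G)) (n : ℕ), t ∈ 𝒜 → ∃ g : BoundedContinuousFunction (Y × G) ℝ,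
      ∫ p, ‖t.indicator 1 p - g p‖ ∂μ ≤ 1 / ((n : ℝ) + 1) := fun t n ht =>
    ((hi t (h𝒜.measurable t ht)).exists_boundedContinuous_integral_sub_le
      (by positivity)).imp fun g hg => hg.1
  choose! g hg using hex
  obtain ⟨e, he⟩ := h𝒜c.exists_eq_range h𝒜.nonempty
  have heA : ∀ k, e k ∈ 𝒜 := fun k => he ▸ mem_range_self k
  refine ⟨ℕ × ℕ, inferInstance, fun j => g (e j.1) j.2, fun j => (g _ _).continuous.measurable,
    fun j y => (g _ _).continuous.comp (by fun_prop), fun j => ⟨‖g (e j.1) j.2‖, fun p =>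
      (g _ _).norm_coe_le_norm p⟩, fun s hs ε hε => ?_⟩
  obtain ⟨t, ht, hst⟩ := h𝒜.approx s hs (measure_ne_top _ _) (ε / 2) (half_pos hε)
  obtain ⟨n, hn⟩ := exists_nat_one_div_lt (half_pos hε)
  obtain ⟨k, rfl⟩ : t ∈ range e := he ▸ ht
  refine ⟨(k, n), ?_⟩
  have hgi : Integrable (g (e k) n) μ := (g (e k) n).integrable μ
  have hm := h𝒜.measurable _ ht
  have h1 : ∫ p, |s.indicator 1 p - (e k).indicator 1 p| ∂μ < ε / 2 := by
    have : ∀ p, |s.indicator (1 : Y × G → ℝ) p - (e k).indicator 1 p| =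
        (symmDiff s (e k)).indicator 1 p := by
      intro p
      by_cases h1 : p ∈ s <;> by_cases h2 : p ∈ e k <;> simp [h1, h2, mem_symmDiff]
    simp_rw [this]
    rw [integral_indicator_one (hs.symmDiff hm)]
    exact (ENNReal.lt_ofReal_iff_toReal_lt (measure_ne_top _ _)).1 hst
  calc ∫ p, |s.indicator 1 p - g (e k) n p| ∂μ
      ≤ ∫ p, (|s.indicator 1 p - (e k).indicator 1 p| + |(e k).indicator 1 p - g (e k) n p|) ∂μ :=
        integral_mono ((hi s hs).sub hgi).abs
          (((hi s hs).sub (hi _ hm)).abs.add ((hi _ hm).sub hgi).abs) fun p => abs_sub_le _ _ _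
    _ = _ := integral_add ((hi s hs).sub (hi _ hm)).abs ((hi _ hm).sub hgi).abs
    _ < ε / 2 + ε / 2 := add_lt_add h1 (lt_of_le_of_lt (hg _ n ht) hn)
    _ = ε := add_halves ε

/-- A measure-preserving map is ergodic as soon as, for an `L¹`-dense family of functions, some ergodic
average is close to the integral. -/
theorem MeasureTheory.MeasurePreserving.ergodic_of_birkhoffAverage {X : Type*} [MeasurableSpace X]
    {μ : Measure X} [IsProbabilityMeasure μ] {S : X → X} (hS : MeasurePreserving S μ μ) {ι : Type*}
    {f : ι → X → ℝ} (hf : ∀ j, Integrable (f j) μ)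
    (happrox : ∀ s, MeasurableSet s → ∀ ε > 0, ∃ j, ∫ p, |s.indicator 1 p - f j p| ∂μ < ε)
    (havg : ∀ j, ∀ δ > 0, ∃ N, N ≠ 0 ∧
      ∫ p, |birkhoffAverage ℝ S (f j) N p - ∫ q, f j q ∂μ| ∂μ < δ) :
    Ergodic S μ := by
  refine ⟨hS, ⟨fun s hs hinv => ?_⟩⟩
  have hi : Integrable (s.indicator (1 : X → ℝ)) μ := (integrable_const (1 : ℝ)).indicator hs
  set a := μ.real s
  have hconst : ∀ ε > 0, ∫ p, |s.indicator 1 p - a| ∂μ ≤ 3 * ε := by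
    intro ε hε
    obtain ⟨j, hj⟩ := happrox s hs ε hε
    obtain ⟨N, hN, hNε⟩ := havg j ε hε
    have hN' : (N : ℝ) ≠ 0 := by exact_mod_cast hN
    set c := ∫ q, f j q ∂μ
    have hd : Integrable (fun p => s.indicator (1 : X → ℝ) p - f j p) μ := hi.sub (hf j)
    have hB := (hf j).birkhoffAverage hS N
    have hiter : ∀ (n : ℕ) p, s.indicator (1 : X → ℝ) (S^[n] p) = s.indicator 1 p := by
      intro n p
      have hmem : S^[n] p ∈ s ↔ p ∈ s := by
        rw [← mem_preimage, Function.IsFixedPt.preimage_iterate hinv n]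
      by_cases h : p ∈ s
      · rw [indicator_of_mem h, indicator_of_mem (hmem.2 h)]
        rfl
      · rw [indicator_of_notMem h, indicator_of_notMem (mt hmem.1 h)]
    -- An invariant indicator is its own ergodic average; each of the three terms has `L¹` norm at
    -- most `ε`.
    have hsplit : ∀ p, s.indicator (1 : X → ℝ) p - a =
        birkhoffAverage ℝ S (fun p => s.indicator (1 : X → ℝ) p - f j p) N p +
          (birkhoffAverage ℝ S (f j) N p - c) + (c - a) := by
      intro p
      simp only [birkhoffAverage_eq_sum, Finset.sum_sub_distrib, hiter, Finset.sum_const,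
        Finset.card_range, nsmul_eq_mul]
      rw [mul_sub, inv_mul_cancel_left₀ hN']
      ring
    have hca : |c - a| ≤ ε := by
      have : ∫ p, (s.indicator (1 : X → ℝ) p - f j p) ∂μ = a - c := by
        rw [integral_sub hi (hf j), integral_indicator_one hs]
      rw [abs_sub_comm, ← this]
      exact abs_integral_le_integral_abs.trans hj.le
    have h1 := (integral_abs_birkhoffAverage_le hd hS N).trans hj.le
    have i1 := (hd.birkhoffAverage hS N).abs
    have i2 : Integrable (fun p => |birkhoffAverage ℝ S (f j) N p - c|) μ :=
      (hB.sub (integrable_const c)).abs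
    calc ∫ p, |s.indicator 1 p - a| ∂μ
        ≤ ∫ p, (|birkhoffAverage ℝ S (fun p => s.indicator (1 : X → ℝ) p - f j p) N p| +
          |birkhoffAverage ℝ S (f j) N p - c| + |c - a|) ∂μ := by
          refine integral_mono (hi.sub (integrable_const a)).abs
            ((i1.add i2).add (integrable_const _)) fun p => ?_
          change |s.indicator 1 p - a| ≤ _
          rw [hsplit p]
          exact abs_add_three _ _ _
      _ = ∫ p, |birkhoffAverage ℝ S (fun p => s.indicator (1 : X → ℝ) p - f j p) N p| ∂μ +
          ∫ p, |birkhoffAverage ℝ S (f j) N p - c| ∂μ + |c - a| := by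
          have i12 : Integrable (fun p =>
            |birkhoffAverage ℝ S (fun p => s.indicator (1 : X → ℝ) p - f j p) N p| +
              |birkhoffAverage ℝ S (f j) N p - c|) μ := i1.add i2
          rw [integral_add i12 (integrable_const _), integral_add i1 i2]
          simp
      _ ≤ 3 * ε := by linarith
  have hzero : ∫ p, |s.indicator 1 p - a| ∂μ ≤ 0 := by
    refine le_of_forall_pos_le_add fun ε hε => ?_
    have := hconst (ε / 3) (by positivity)
    linarith
  have hae : ∀ᵐ p ∂μ, s.indicator (1 : X → ℝ) p = a := by
    have h0 := (integral_eq_zero_iff_of_nonneg (fun p => abs_nonneg _)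
      (hi.sub (integrable_const a)).abs).1 (le_antisymm hzero (integral_nonneg fun p => abs_nonneg _))
    filter_upwards [h0] with p hp
    exact sub_eq_zero.1 (abs_eq_zero.1 hp)
  rw [eventuallyConst_set]
  by_cases ha : a = 0
  · right
    filter_upwards [hae] with p hp hps
    rw [indicator_of_mem hps, ha] at hp
    exact one_ne_zero hp
  · left
    filter_upwards [hae] with p hp
    by_contra hps
    rw [indicator_of_notMem hps] at hp
    exact ha hp.symm

theorem tendsto_skewProduct_iterate_snd {Y G : Type*} [Group G] [MetricSpace G]
    [IsTopologicalGroup G] {T : Y → Y} {u : ℕ → Y → G} {φ : Y → G} {p : Y × G}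
    (h : ∀ i : ℕ, Tendsto (fun k => u k (T^[i] p.1)) atTop (𝓝 (φ (T^[i] p.1)))) (n : ℕ) :
    Tendsto (fun k => ((skewProduct T (u k))^[n] p).2) atTop (𝓝 ((skewProduct T φ)^[n] p).2) := by
  induction n with
  | zero => exact tendsto_const_nhds
  | succ n ih =>
    simp only [Function.iterate_succ_apply', skewProduct, skewProduct_iterate_fst]
    exact (h n).mul ih

section Generic

variable {Y : Type*} [MeasurableSpace Y] {ν : Measure Y} [IsProbabilityMeasure ν]
  {G : Type*} [Group G] [MetricSpace G] [IsTopologicalGroup G] [MeasurableSpace G] [BorelSpace G]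
  [SecondCountableTopology G] {lam : Measure G} [IsProbabilityMeasure lam]

theorem measurable_skewProduct {T : Y → Y} (hT : Measurable T) {φ : Y → G} (hφ : Measurable φ) :
    Measurable (skewProduct T φ) :=
  (hT.comp measurable_fst).prodMk ((hφ.comp measurable_fst).mul measurable_snd)

/-- Every subsequence has a further one converging almost everywhere, hence along almost all
`T`-orbits. Continuity of `f` in `g` and dominated convergence then give the limit. -/
theorem continuous_integral_abs_birkhoffAverage_sub {T : Y → Y} (hT : MeasurePreserving T ν ν)
    {f : Y × G → ℝ} (hf : Measurable f) (hfc : ∀ y, Continuous fun g => f (y, g)) {C : ℝ}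
    (hC : ∀ p, |f p| ≤ C) (c : ℝ) (N : ℕ) :
    Continuous fun φ : CocycleSpace ν G =>
      ∫ p, |birkhoffAverage ℝ (skewProduct T φ.rep) f N p - c| ∂(ν.prod lam) := by
  refine continuous_iff_seqContinuous.2 fun u φ hu => tendsto_of_subseq_tendsto fun ns hns => ?_
  obtain ⟨ms, -, hms⟩ := CocycleSpace.exists_subseq_ae_tendsto (hu.comp hns)
  refine ⟨ms, ?_⟩
  have hae : ∀ᵐ y ∂ν, ∀ i : ℕ, Tendsto (fun k => (u (ns (ms k))).rep (T^[i] y)) atTop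
      (𝓝 (φ.rep (T^[i] y))) :=
    ae_all_iff.2 fun i => (hT.iterate i).quasiMeasurePreserving.ae hms
  have hae' : ∀ᵐ p ∂(ν.prod lam), ∀ i : ℕ, Tendsto (fun k => (u (ns (ms k))).rep (T^[i] p.1)) atTop
      (𝓝 (φ.rep (T^[i] p.1))) := Measure.quasiMeasurePreserving_fst.ae hae
  refine tendsto_integral_of_dominated_convergence (fun _ => C + |c|) (fun k => ?_)
    (integrable_const _) (fun k => ae_of_all _ fun p => ?_) ?_
  · exact ((hf.birkhoffAverage (measurable_skewProduct hT.measurable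
      (CocycleSpace.measurable_rep _)) N).sub_const c).abs.aestronglyMeasurable
  · rw [Real.norm_eq_abs, abs_abs]
    exact (abs_sub _ _).trans (add_le_add_left (abs_birkhoffAverage_le hC N _) _)
  · filter_upwards [hae'] with p hp
    refine Tendsto.abs (Tendsto.sub_const ?_ c)
    simp only [birkhoffAverage_eq_sum]
    refine (tendsto_finsetSum _ fun n _ => ?_).const_mul _
    have hpair : ∀ ψ : Y → G, (skewProduct T ψ)^[n] p = (T^[n] p.1, ((skewProduct T ψ)^[n] p).2) :=
      fun ψ => Prod.ext (skewProduct_iterate_fst T ψ p n) rfl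
    rw [hpair φ.rep]
    refine Tendsto.congr (fun k => congrArg f (hpair _).symm) ?_
    exact ((hfc (T^[n] p.1)).tendsto _).comp (tendsto_skewProduct_iterate_snd hp n)

end Generic

/-! ### Invariance of normalized Haar measure. -/

section Haar

variable (G : Type*) [Group G] [TopologicalSpace G] [IsTopologicalGroup G] [CompactSpace G]
  [MeasurableSpace G] [BorelSpace G]

instance normalizedHaar.instIsHaarMeasure : (normalizedHaar G).IsHaarMeasure :=
  inferInstanceAs (Measure.haarMeasure _).IsHaarMeasure

instance normalizedHaar.instIsProbabilityMeasure : IsProbabilityMeasure (normalizedHaar G) :=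
  ⟨Measure.haarMeasure_self (K₀ := (⊤ : TopologicalSpace.PositiveCompacts G))⟩

/-- A right translate is again a Haar probability measure, and such a measure is unique. -/
instance normalizedHaar.instIsMulRightInvariant : (normalizedHaar G).IsMulRightInvariant where
  map_mul_right_eq_self g :=
    have : IsProbabilityMeasure ((normalizedHaar G).map (· * g)) :=
      Measure.isProbabilityMeasure_map (measurable_mul_const g).aemeasurable
    Measure.isHaarMeasure_eq_of_isProbabilityMeasure _ _

end Haar

/-- Let `(Y, ν, T)` be an infinite ergodic system on a standard probability space and `G` a compact
second countable group with a metric inducing its topology. The space of cocycles with the metric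
of convergence in measure is Polish, and for all `φ` in a dense `G_δ` subset of it the skew product
`T_φ` is ergodic for the product of `ν` and the normalized Haar measure. -/
theorem mainTheorem6 {Y : Type*} [MeasurableSpace Y] [StandardBorelSpace Y]
    (ν : Measure Y) [IsProbabilityMeasure ν] (T : Y ≃ᵐ Y) (hT : Ergodic T ν)
    (hY : IsInfiniteSystem ν)
    {G : Type*} [Group G] [MetricSpace G] [IsTopologicalGroup G] [CompactSpace G]
    [MeasurableSpace G] [BorelSpace G] :
    PolishSpace (CocycleSpace ν G) ∧
      ∃ S : Set (CocycleSpace ν G), IsGδ S ∧ Dense S ∧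
        ∀ φ ∈ S, Ergodic (skewProduct T φ.rep) (ν.prod (normalizedHaar G)) := by
  refine ⟨CocycleSpace.polishSpace, ?_⟩
  have hmp := hT.toMeasurePreserving
  obtain ⟨ι, hι, f, hf, hfc, hfC, happrox⟩ :=
    exists_seq_bounded_approx_indicator (ν.prod (normalizedHaar G))
  choose C hC using hfC
  -- The time `N` is existentially quantified, so the union remains open; the second index runs over
  -- a countable set of tolerances.
  let U : ι × ℕ → Set (CocycleSpace ν G) := fun j =>
    ⋃ (N : ℕ) (_ : N ≠ 0), {φ | ∫ p, |birkhoffAverage ℝ (skewProduct T φ.rep) (f j.1) N p -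
      ∫ q, f j.1 q ∂(ν.prod (normalizedHaar G))| ∂(ν.prod (normalizedHaar G)) <
        1 / ((j.2 : ℝ) + 1)}
  have hopen : ∀ j, IsOpen (U j) := fun j =>
    isOpen_iUnion fun N => isOpen_iUnion fun _ => isOpen_lt
      (continuous_integral_abs_birkhoffAverage_sub hmp (hf _) (hfc _) (hC _) _ N) continuous_const
  have hdense : ∀ j, Dense (U j) := by
    intro j
    refine Metric.dense_iff.2 fun φ ε hε => ?_
    obtain ⟨b, hb, hbε, N, hN, hNδ⟩ := hT.exists_coboundary_birkhoffAverage_lt hY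
      (lam := normalizedHaar G) φ.measurable_rep (hf j.1) (hC j.1) (half_pos hε)
      (show (0 : ℝ) < 1 / ((j.2 : ℝ) + 1) by positivity)
    have hψ : AEStronglyMeasurable (fun y => b (T y) * (b y)⁻¹) ν :=
      ((hb.comp T.measurable).mul hb.inv).aestronglyMeasurable
    refine ⟨CocycleSpace.of _ hψ, ?_, ?_⟩
    · rw [Metric.mem_ball]
      have h := CocycleSpace.dist_of_le hψ φ.stronglyMeasurable_rep.aestronglyMeasurable hbε
      rw [CocycleSpace.of_rep] at h
      exact h.trans_lt (half_lt_self hε)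
    · simp only [U, mem_iUnion, mem_ofPred_eq]
      refine ⟨N, hN, lt_of_le_of_lt (le_of_eq (integral_congr_ae ?_)) hNδ⟩
      filter_upwards [birkhoffAverage_skewProduct_congr_ae (lam := normalizedHaar G) hmp
        (CocycleSpace.rep_of_ae_eq _ hψ) (f j.1) N] with p hp
      rw [hp]
  refine ⟨⋂ j, U j, .iInter fun j => (hopen j).isGδ, dense_iInter_of_isOpen hopen hdense,
    fun φ hφ => ?_⟩
  refine (measurePreserving_skew hmp φ.measurable_rep).ergodic_of_birkhoffAverage
    (fun j => integrable_of_abs_le (hf j) (hC j)) happrox fun j δ hδ => ?_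
  obtain ⟨k, hk⟩ := exists_nat_one_div_lt hδ
  have h := mem_iInter.1 hφ (j, k)
  simp only [U, mem_iUnion, mem_ofPred_eq] at h
  obtain ⟨N, hN, h⟩ := h
  exact ⟨N, hN, h.trans hk⟩
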